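/- **Equivalence of iterative Dirichlet-copula sampling.** Let $U[0,1]$ be the uniform distribution and $\mathrm{Gamma}[n,1]$ the distribution with density $x^{n-1}e^{-x}/(n-1)!$ on $x\ge 0$. *Original sampling.* For $n\ge 1$ draw $U^{(1)},\dots,U^{(n)}$ i.i.d. from $U[0,1]$ and put $$E^{(s)}=-\log U^{(s)},\qquad d^{(s)}=\frac{\log U^{(s)}}{\sum_{s'=1}^n\log U^{(s')}}=\frac{E^{(s)}}{\sum_{s'=1}^nE^{(s')}},\qquad \tilde u^{(s)}=1-(1-d^{(s)})^{n-1}.$$ *Iterative sampling.* Draw $T\sim\mathrm{Gamma}[n,1]$ and, independently, $V_1,\dots,V_{n-1}$ i.i.d. from $U[0,1]$. Put $R_0=T$ and, for $s=1,\dots,n$, $$E_*^{(s)}=\begin{cases}R_{s-1}-R_{s-1}V_s^{1/(n-s)}&(s<n)\\ R_{s-1}&(s=n)\end{cases},\qquad R_s=R_{s-1}-E_*^{(s)},\qquad d_*^{(s)}=\frac{E_*^{(s)}}{T},\qquad \tilde u_*^{(s)}=1-(1-d_*^{(s)})^{n-1}.$$ **(A)** For every $n\ge 1$: 1. $\sum_{s=1}^nE^{(s)}\sim\mathrm{Gamma}[n,1]$;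 2. for every $s<n$, the conditional distribution of $E^{(s)}$ given the remaining sum $\sum_{s'\ge s}E^{(s')}=r$ is, for almost every $r$ with respect to the law of this sum, the distribution of $r-rV^{1/(n-s)}$ with $V\sim U[0,1]$; 3. $\sum_{s=1}^nE_*^{(s)}=T$ always; 4. the random vectors $(E_*^{(s)})_{s=1}^n$, $(d_*^{(s)})_{s=1}^n$, $(\tilde u_*^{(s)})_{s=1}^n$ have the same joint distributions as $(E^{(s)})_{s=1}^n$, $(d^{(s)})_{s=1}^n$, $(\tilde u^{(s)})_{s=1}^n$, respectively. *ARMS.* Let $d\ge1$, $n\ge2$, $J:\{0,1\}^d\to\mathbb R$, $\theta\in(0,1)^d$ and $p_\theta(z)=\prod_i\theta_i^{z_i}(1-\theta_i)^{1-z_i}$. The *original ARMS estimator* draws, independently for every $i\in\{1,\dots,d\}$, variables $\tilde u_i^{(1)},\dots,\tilde u_i^{(n)}$ by the original sampling; if $\theta_i>1/2$ it puts $\tilde z_i^{(s)}=\mathbf 1[\tilde u_i^{(s)}\le\theta_i]$ and $q_i=1-\theta_i$, and otherwise $\tilde z_i^{(s)}=\mathbf 1[1-\tilde u_i^{(s)}\le\theta_i]$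 and $q_i=\theta_i$; it puts $$\rho_i=\frac{\max(0,2q_i^{1/(n-1)}-1)^{n-1}-q_i^2}{\theta_i(1-\theta_i)}$$ and returns the vector $\hat g$ with coordinates $$\hat g_i=\frac1{1-\rho_i}\cdot\frac1n\sum_{s=1}^n\Big(J(\tilde z^{(s)})-\frac1{n-1}\sum_{s'\ne s}J(\tilde z^{(s')})\Big)\frac{\partial\log p_\theta}{\partial\theta_i}(\tilde z^{(s)}).$$ The *iterative ARMS algorithm* first draws, for each $i$, a total $T_i\sim\mathrm{Gamma}[n,1]$, computes $\rho_i$, and sets $\bar J=0$, $\Lambda=\Lambda^J=0\in\mathbb R^d$. For $s=1,\dots,n$ it performs, for each $i$, the $s$-th round of the iterative sampling with fresh uniforms (keeping only $T_i$ and the current remaining sum $R_i$), obtains $\tilde z_i^{(s)}$ from $\tilde u_i^{(s)}$ as above, evaluates $J(\tilde z^{(s)})$ and updates $$\bar J\leftarrow\tfrac{s-1}s\bar J+\tfrac1sJ(\tilde z^{(s)}),\qquad \Lambda\leftarrow\tfrac{\max(s-2,1)}{\max(s-1,1)}\Lambda+\tfrac1{\max(s-1,1)}\nabla_\theta\log p_\theta(\tilde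 z^{(s)}),$$ $$\Lambda^J\leftarrow\tfrac{\max(s-2,1)}{\max(s-1,1)}\Lambda^J+\tfrac1{\max(s-1,1)}J(\tilde z^{(s)})\nabla_\theta\log p_\theta(\tilde z^{(s)}).$$ It returns the vector with coordinates $\frac1{1-\rho_i}(\Lambda^J_i-\Lambda_i\bar J)$. It is implemented as a program of a randomized machine with real registers, whose instructions are arithmetic assignments, comparisons, `for` loops, sampling from $U[0,1]$ and from $\mathrm{Gamma}[m,1]$ with natural $m$, and queries to an oracle for $J$. The score is computed coordinatewise as $z_i/\theta_i-(1-z_i)/(1-\theta_i)$. The inputs are $n$ and $\theta$, and the program depends only on $d$. Its memory is the number of registers plus the scratch space for intermediate results, the arguments of a query and loop control, counted in real numbers; memory used inside the oracle is not counted. **(B)** There is a constant $C$ such that for every $d\ge1$ the iterative ARMS program uses memory at most $C\,d$ (independently of the number of samples $n$), and for all $n\ge2$, $J:\{0,1\}^d\to\mathbb R$ and $\theta\in(0,1)^d$ its output has the same distribution as the original ARMS estimator. -/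

import Mathlib

open MeasureTheory ProbabilityTheory

noncomputable section

namespace ARMS

/-! ### Sampling the Dirichlet copula -/

/-- The uniform distribution `U[0,1]`, as a measure on `ℝ`. -/
def unif : Measure ℝ := (volume : Measure ℝ).restrict (Set.Icc 0 1)

instance : IsProbabilityMeasure unif := ⟨by simp [unif]⟩

/-- The law of `n` i.i.d. uniforms. -/
def iidUnif (n : ℕ) : Measure (Fin n → ℝ) := Measure.pi fun _ => unif

instance (n : ℕ) : IsProbabilityMeasure (iidUnif n) := by
  unfold iidUnif; infer_instance

/-- `E^{(s)} = - log U^{(s)}`. -/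
def origE {n : ℕ} (u : Fin n → ℝ) (s : Fin n) : ℝ := -Real.log (u s)

/-- `d^{(s)} = log U^{(s)} / ∑_{s'} log U^{(s')}`. -/
def origDir {n : ℕ} (u : Fin n → ℝ) (s : Fin n) : ℝ :=
  Real.log (u s) / ∑ t, Real.log (u t)

/-- The marginal distribution function of a Dirichlet variable, applied to each coordinate. -/
def copula {n : ℕ} (x : Fin n → ℝ) (s : Fin n) : ℝ := 1 - (1 - x s) ^ (n - 1)

/-- The inverse-transform draw `r - r v ^ (1 / (n - s))`. -/
def invDraw (n s : ℕ) (r v : ℝ) : ℝ := r - r * v ^ (1 / ((n : ℝ) - s))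

/-- The draw made in round `s = k + 1` of the iterative procedure when the remaining sum is `r`:
an inverse-transform draw while `s < n`, and the whole remaining sum in the last round. -/
def iterDraw (n : ℕ) (v : Fin (n - 1) → ℝ) (k : ℕ) (r : ℝ) : ℝ :=
  if h : k < n - 1 then invDraw n (k + 1) r (v ⟨k, h⟩) else r

/-- The remaining sum after `k` rounds, started from the total `T`. -/
def iterRem (n : ℕ) (T : ℝ) (v : Fin (n - 1) → ℝ) : ℕ → ℝ
  | 0 => T
  | k + 1 => iterRem n T v k - iterDraw n v k (iterRem n T v k)

/-- The summands `E^{(1)}, …, E^{(n)}` produced by the iterative procedure. -/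
def iterE {n : ℕ} (p : ℝ × (Fin (n - 1) → ℝ)) (s : Fin n) : ℝ :=
  iterDraw n p.2 s (iterRem n p.1 p.2 s)

/-- The Dirichlet variables produced by the iterative procedure: each summand is divided by the
total, which was sampled first. -/
def iterDir {n : ℕ} (p : ℝ × (Fin (n - 1) → ℝ)) (s : Fin n) : ℝ := iterE p s / p.1

/-- The randomness of the iterative procedure: the total is drawn from `Gamma[n,1]`, and,
independently, `n - 1` i.i.d. uniforms are drawn. -/
def iterSource (n : ℕ) : Measure (ℝ × (Fin (n - 1) → ℝ)) :=
  (gammaMeasure n 1).prod (iidUnif (n - 1))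

/-! ### The original ARMS estimator -/

/-- The product Bernoulli probability `p_θ(z)`. -/
def bernProb {d : ℕ} (θ : Fin d → ℝ) (z : Fin d → Bool) : ℝ :=
  ∏ i, if z i then θ i else 1 - θ i

/-- The score `∇_θ log p_θ(z)`, as the vector of partial derivatives. -/
def score {d : ℕ} (θ : Fin d → ℝ) (z : Fin d → Bool) (i : Fin d) : ℝ :=
  deriv (fun t => Real.log (bernProb (Function.update θ i t) z)) (θ i)

/-- The leave-one-out estimator. -/
def loorf {d n : ℕ} (J : (Fin d → Bool) → ℝ) (θ : Fin d → ℝ) (z : Fin n → Fin d → Bool)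
    (i : Fin d) : ℝ :=
  (1 / (n : ℝ)) * ∑ s, (J (z s) - (1 / ((n : ℝ) - 1)) * ∑ t ∈ Finset.univ.erase s, J (z t)) *
    score θ (z s) i

/-- The correlation correction for a coordinate with parameter `t`. -/
def armsRho (n : ℕ) (t : ℝ) : ℝ :=
  if t > 1 / 2 then
    (max 0 (2 * (1 - t) ^ (1 / ((n : ℝ) - 1)) - 1) ^ (n - 1) - (1 - t) ^ 2) / (t * (1 - t))
  else
    (max 0 (2 * t ^ (1 / ((n : ℝ) - 1)) - 1) ^ (n - 1) - t ^ 2) / (t * (1 - t))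

open Classical in
/-- The Bernoulli sample obtained from a copula uniform `w` for the parameter `t`. -/
def armsBit (t w : ℝ) : Bool :=
  if t > 1 / 2 then decide (w ≤ t) else decide (1 - w ≤ t)

/-- The original ARMS estimator with Dirichlet copulas, as a function of the `d × n` uniforms. -/
def origARMS {d n : ℕ} (J : (Fin d → Bool) → ℝ) (θ : Fin d → ℝ) (u : Fin d → Fin n → ℝ)
    (i : Fin d) : ℝ :=
  1 / (1 - armsRho n (θ i)) *
    loorf J θ (fun s j => armsBit (θ j) (copula (origDir (u j)) s)) i

/-- The law of the original ARMS estimator, from `d × n` i.i.d. uniforms. -/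
def origARMSLaw (d n : ℕ) (J : (Fin d → Bool) → ℝ) (θ : Fin d → ℝ) : Measure (Fin d → ℝ) :=
  (Measure.pi fun _ : Fin d => iidUnif n).map (origARMS J θ)

/-! ### A randomized machine with real registers -/

/-- Arithmetic expressions over the registers `ι`. -/
inductive Expr (ι : Type) : Type
  | const (m : ℕ)
  | reg (x : ι)
  | add (a b : Expr ι)
  | sub (a b : Expr ι)
  | mul (a b : Expr ι)
  | div (a b : Expr ι)
  | pow (a b : Expr ι)
  | max (a b : Expr ι)

namespace Expr

variable {ι : Type}

/-- The value of an expression in a machine state. -/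
def eval : Expr ι → (ι → ℝ) → ℝ
  | const m, _ => m
  | reg x, σ => σ x
  | add a b, σ => a.eval σ + b.eval σ
  | sub a b, σ => a.eval σ - b.eval σ
  | mul a b, σ => a.eval σ * b.eval σ
  | div a b, σ => a.eval σ / b.eval σ
  | pow a b, σ => a.eval σ ^ b.eval σ
  | max a b, σ => Max.max (a.eval σ) (b.eval σ)

/-- The number of nodes; it bounds the number of intermediate results kept in an evaluation. -/
def size : Expr ι → ℕ
  | const _ => 1
  | reg _ => 1
  | add a b => a.size + b.size + 1
  | sub a b => a.size + b.size + 1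
  | mul a b => a.size + b.size + 1
  | div a b => a.size + b.size + 1
  | pow a b => a.size + b.size + 1
  | max a b => a.size + b.size + 1

theorem measurable_eval (e : Expr ι) : Measurable e.eval := by
  induction e with
  | const m => exact measurable_const
  | reg x => exact measurable_pi_apply x
  | add a b iha ihb => exact iha.add ihb
  | sub a b iha ihb => exact iha.sub ihb
  | mul a b iha ihb => exact iha.mul ihb
  | div a b iha ihb => exact iha.div ihb
  | pow a b iha ihb => exact iha.pow ihb
  | max a b iha ihb => exact iha.max ihb

end Expr

/-- Commands of a machine with the registers `ι`, which can query an oracle for a function on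
`{0,1}^d`. -/
inductive Cmd (ι : Type) (d : ℕ) : Type
  | skip
  /-- `x ← e`. -/
  | assign (x : ι) (e : Expr ι)
  /-- Sample `x ∼ U[0,1]`. -/
  | uniform (x : ι)
  /-- Sample `x ∼ Gamma[m,1]`, with `m` the natural number stored in `b`. -/
  | gamma (x b : ι)
  /-- `x ← J(z)`, where the `i`-th bit of `z` is one iff the register `z i` holds one. -/
  | query (x : ι) (z : Fin d → ι)
  | seq (c₁ c₂ : Cmd ι d)
  /-- If `a ≤ b` then `c₁` else `c₂`. -/
  | ite (a b : Expr ι) (c₁ c₂ : Cmd ι d)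
  /-- For `x = 1, …, m` do `c`, with `m` the natural number stored in `b`. -/
  | loop (x b : ι) (c : Cmd ι d)

open Classical in
/-- The bits held by the registers `z`. -/
def bits {ι : Type} {d : ℕ} (z : Fin d → ι) (σ : ι → ℝ) (i : Fin d) : Bool :=
  decide (σ (z i) = 1)

theorem measurable_bits {ι : Type} {d : ℕ} (z : Fin d → ι) : Measurable (bits z) := by
  classical
  refine measurable_pi_iff.2 fun i => ?_
  refine measurable_to_bool ?_
  have h : (fun σ : ι → ℝ => bits z σ i) ⁻¹' {true} = {σ | σ (z i) = 1} := by
    ext σ; simp [bits]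
  rw [h]
  exact measurableSet_eq_fun (measurable_pi_apply (z i)) measurable_const

/-- The distribution `Gamma[m,1]`; for `m = 0` it is the point mass at `0`. -/
def gammaNat (m : ℕ) : Measure ℝ := if m = 0 then Measure.dirac 0 else gammaMeasure m 1

instance (m : ℕ) : IsProbabilityMeasure (gammaNat m) := by
  unfold gammaNat
  split_ifs with h
  · infer_instance
  · exact isProbabilityMeasure_gammaMeasure (by positivity) one_pos

/-- The kernel that samples `Gamma[m,1]`, with `m` the natural number stored in `b`. -/
def gammaKernel {ι : Type} (b : ι) : Kernel (ι → ℝ) ℝ where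
  toFun σ := gammaNat ⌊σ b⌋₊
  measurable' := (measurable_from_top (f := gammaNat)).comp
    (Nat.measurable_floor.comp (measurable_pi_apply b))

instance {ι : Type} (b : ι) : IsMarkovKernel (gammaKernel b) :=
  ⟨fun σ => inferInstanceAs (IsProbabilityMeasure (gammaNat ⌊σ b⌋₊))⟩

section Semantics

variable {ι : Type} [DecidableEq ι]

/-- Store in the register `x` a value drawn from a kernel. -/
def storeKernel (x : ι) (κ : Kernel (ι → ℝ) ℝ) : Kernel (ι → ℝ) (ι → ℝ) :=
  (Kernel.id ×ₖ κ).map fun p => Function.update p.1 x p.2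

/-- Store in the register `x` a measurable function of the state. -/
def storeFun (x : ι) (f : (ι → ℝ) → ℝ) (hf : Measurable f) : Kernel (ι → ℝ) (ι → ℝ) :=
  Kernel.deterministic (fun σ => Function.update σ x (f σ)) <| by
    refine measurable_pi_iff.2 fun y => ?_
    by_cases h : y = x
    · subst h; simpa using hf
    · simpa [Function.update_of_ne h] using measurable_pi_apply y

/-- The kernel of `m` rounds of a loop with counter `x` and body `κ`. -/
def rounds (x : ι) (κ : Kernel (ι → ℝ) (ι → ℝ)) : ℕ → Kernel (ι → ℝ) (ι → ℝ)
  | 0 => Kernel.id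
  | m + 1 => κ ∘ₖ storeFun x (fun _ => ((m + 1 : ℕ) : ℝ)) measurable_const ∘ₖ rounds x κ m

/-- The kernel of a loop whose number of rounds is stored in the register `b` on entry. -/
def loopKernel (x b : ι) (κ : Kernel (ι → ℝ) (ι → ℝ)) : Kernel (ι → ℝ) (ι → ℝ) where
  toFun σ := rounds x κ ⌊σ b⌋₊ σ
  measurable' := by
    have h : Measurable fun p : ℕ × (ι → ℝ) => rounds x κ p.1 p.2 :=
      measurable_from_prod_countable_right fun m => (rounds x κ m).measurable
    exact h.comp ((Nat.measurable_floor.comp (measurable_pi_apply b)).prodMk measurable_id)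

end Semantics

namespace Cmd

variable {ι : Type} {d : ℕ}

open Classical in
/-- The semantics of a command: the Markov kernel which sends an initial state to the law of the
final state. All samples are drawn with fresh randomness. -/
def run [DecidableEq ι] (J : (Fin d → Bool) → ℝ) : Cmd ι d → Kernel (ι → ℝ) (ι → ℝ)
  | skip => Kernel.id
  | assign x e => storeFun x e.eval e.measurable_eval
  | uniform x => storeKernel x (Kernel.const _ unif)
  | gamma x b => storeKernel x (gammaKernel b)
  | query x z => storeFun x (fun σ => J (bits z σ))
      ((measurable_of_finite J).comp (measurable_bits z))
  | seq c₁ c₂ => c₂.run J ∘ₖ c₁.run J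
  | ite a b c₁ c₂ =>
      Kernel.piecewise (measurableSet_le a.measurable_eval b.measurable_eval)
        (c₁.run J) (c₂.run J)
  | loop x b c => loopKernel x b (c.run J)

/-- The working memory used in addition to the registers: intermediate results of expressions, a
buffer for the argument of an oracle query, and the position and the length of every loop that is
being executed. -/
def scratch : Cmd ι d → ℕ
  | skip => 0
  | assign _ e => e.size
  | uniform _ => 1
  | gamma _ _ => 1
  | query _ _ => d + 1
  | seq c₁ c₂ => max c₁.scratch c₂.scratch
  | ite a b c₁ c₂ => max (a.size + b.size) (max c₁.scratch c₂.scratch)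
  | loop _ _ c => c.scratch + 2

/-- The memory of a program, in real numbers: its registers and its additional working memory. -/
def memory [Fintype ι] (c : Cmd ι d) : ℕ := Fintype.card ι + c.scratch

/-- Execute a list of commands in order. -/
def block : List (Cmd ι d) → Cmd ι d
  | [] => skip
  | c :: l => seq c (block l)

/-- For `i = 1, …, d` do `f i`. -/
def forDim (f : Fin d → Cmd ι d) : Cmd ι d := block ((List.finRange d).map f)

end Cmd

/-! ### The iterative ARMS program -/

/-- Names of the vectors of length `d`: the parameter, the sampled total, the remaining sum, the
correlation, the current sample, the accumulators of the score and of `J` times the score, and the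
output. -/
inductive VecName : Type
  | theta | total | rem | rho | z | accS | accJS | g
  deriving DecidableEq

instance : Fintype VecName :=
  ⟨{.theta, .total, .rem, .rho, .z, .accS, .accJS, .g}, fun x => by cases x <;> decide⟩

/-- Names of the scalars: the number of samples, the loop counter, a uniform sample, the current
summand, the current Dirichlet variable, the current copula uniform, the value of `J` at the
current sample, and the running mean of these values. -/
inductive ScalName : Type
  | n | s | u | e | dir | w | j | meanJ
  deriving DecidableEq

instance : Fintype ScalName :=
  ⟨{.n, .s, .u, .e, .dir, .w, .j, .meanJ}, fun x => by cases x <;> decide⟩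

/-- The registers of the iterative ARMS program in dimension `d`. -/
abbrev Reg (d : ℕ) : Type := (VecName × Fin d) ⊕ ScalName

section Program

variable {d : ℕ}

/-- The scalar register with a given name. -/
abbrev S (a : ScalName) : Reg d := Sum.inr a

/-- The `i`-th register of the vector with a given name. -/
abbrev V (a : VecName) (i : Fin d) : Reg d := Sum.inl (a, i)

/-- The content of a scalar register. -/
abbrev rs (a : ScalName) : Expr (Reg d) := .reg (S a)

/-- The content of a vector register. -/
abbrev rv (a : VecName) (i : Fin d) : Expr (Reg d) := .reg (V a i)

/-- `(max(0, 2 t^{1/(n-1)} - 1)^{n-1} - t²) / (θ_i (1 - θ_i))`. -/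
def rhoExpr (i : Fin d) (t : Expr (Reg d)) : Expr (Reg d) :=
  .div
    (.sub
      (.pow
        (.max (.const 0)
          (.sub (.mul (.const 2) (.pow t (.div (.const 1) (.sub (rs .n) (.const 1)))))
            (.const 1)))
        (.sub (rs .n) (.const 1)))
      (.mul t t))
    (.mul (rv .theta i) (.sub (.const 1) (rv .theta i)))

/-- Compute the correlation of coordinate `i`. -/
def rhoCmd (i : Fin d) : Cmd (Reg d) d :=
  .ite (rv .theta i) (.div (.const 1) (.const 2))
    (.assign (V .rho i) (rhoExpr i (rv .theta i)))
    (.assign (V .rho i) (rhoExpr i (.sub (.const 1) (rv .theta i))))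

/-- Sample bit `i` of the current sample. -/
def sampleCmd (i : Fin d) : Cmd (Reg d) d := .block [
  .ite (rs .n) (rs .s)
    (.assign (S .e) (rv .rem i))
    (.seq (.uniform (S .u))
      (.assign (S .e) (.sub (rv .rem i)
        (.mul (rv .rem i) (.pow (rs .u) (.div (.const 1) (.sub (rs .n) (rs .s)))))))),
  .assign (V .rem i) (.sub (rv .rem i) (rs .e)),
  .assign (S .dir) (.div (rs .e) (rv .total i)),
  .assign (S .w)
    (.sub (.const 1) (.pow (.sub (.const 1) (rs .dir)) (.sub (rs .n) (.const 1)))),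
  .ite (rv .theta i) (.div (.const 1) (.const 2))
    (.ite (.sub (.const 1) (rs .w)) (rv .theta i)
      (.assign (V .z i) (.const 1)) (.assign (V .z i) (.const 0)))
    (.ite (rs .w) (rv .theta i)
      (.assign (V .z i) (.const 1)) (.assign (V .z i) (.const 0)))]

/-- The `i`-th partial derivative of `log p_θ(z) = ∑ z log θ + (1 - z) log (1 - θ)`. -/
def scoreExpr (i : Fin d) : Expr (Reg d) :=
  .sub (.div (rv .z i) (rv .theta i))
    (.div (.sub (.const 1) (rv .z i)) (.sub (.const 1) (rv .theta i)))

/-- `max(s-2,1)/max(s-1,1) * a + 1/max(s-1,1) * b`. -/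
def accExpr (a b : Expr (Reg d)) : Expr (Reg d) :=
  .add
    (.mul (.div (.max (.sub (rs .s) (.const 2)) (.const 1))
      (.max (.sub (rs .s) (.const 1)) (.const 1))) a)
    (.mul (.div (.const 1) (.max (.sub (rs .s) (.const 1)) (.const 1))) b)

/-- One round of the main loop: draw a sample, query the function and update the accumulators. -/
def roundCmd (d : ℕ) : Cmd (Reg d) d := .block [
  .forDim sampleCmd,
  .query (S .j) (V .z),
  .assign (S .meanJ) (.add
    (.mul (.div (.sub (rs .s) (.const 1)) (rs .s)) (rs .meanJ))
    (.mul (.div (.const 1) (rs .s)) (rs .j))),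
  .forDim fun i => .seq
    (.assign (V .accS i) (accExpr (rv .accS i) (scoreExpr i)))
    (.assign (V .accJS i) (accExpr (rv .accJS i) (.mul (rs .j) (scoreExpr i))))]

/-- The iterative ARMS program. Neither its registers nor its code depend on the number of
samples, which is an input. -/
def iterARMS (d : ℕ) : Cmd (Reg d) d := .block [
  .assign (S .meanJ) (.const 0),
  .forDim fun i => .seq (.assign (V .accS i) (.const 0)) (.assign (V .accJS i) (.const 0)),
  .forDim fun i => .seq (.gamma (V .total i) (S .n)) (.assign (V .rem i) (rv .total i)),
  .forDim rhoCmd,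
  .loop (S .s) (S .n) (roundCmd d),
  .forDim fun i => .assign (V .g i)
    (.mul (.div (.const 1) (.sub (.const 1) (rv .rho i)))
      (.sub (rv .accJS i) (.mul (rv .accS i) (rs .meanJ))))]

/-- The initial state holds the number of samples and the parameter; all other registers are
zero. -/
def initState (n : ℕ) (θ : Fin d → ℝ) : Reg d → ℝ
  | .inl (.theta, i) => θ i
  | .inr .n => n
  | _ => 0

/-- The output vector of a final state. -/
def output (σ : Reg d → ℝ) (i : Fin d) : ℝ := σ (V .g i)

end Program

/-- The law of the output of the iterative ARMS program. -/
def iterARMSLaw (d n : ℕ) (J : (Fin d → Bool) → ℝ) (θ : Fin d → ℝ) : Measure (Fin d → ℝ) :=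
  ((iterARMS d).run J (initState n θ)).map output

end ARMS

end

/-! Part (A) rests on one identity, `gamma_split`: if `T` is `Gamma[k+2,1]` and `V` is an
independent uniform, then `T - T V^(1/(k+1))` and `T V^(1/(k+1))` are independent, with an
exponential and a `Gamma[k+1,1]` law. It is a change of variables in the joint density. Read from
right to left, it gives the law of a sum of exponentials and the law of one summand given the sum
(`map_prodMk_gamma_split`, `map_sum_origE`, `condDistrib_origE`). Read from left to right, it says
that each round of the iterative procedure removes a fresh exponential and leaves an independent
Gamma total of one lower shape, so by induction the procedure yields i.i.d. exponentials
(`map_iterE_succ`), which is the law of `-log U`. Since the iterative summands add up to `T`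
pointwise, the Dirichlet and copula vectors are on both sides the same function of the summands.

For part (B), the kernel semantics is replaced by deterministic functions. `Simulates` forgets the
temporary registers and expresses the law of the remaining view as the image of explicit product
randomness; this relation is closed under sequencing, coordinatewise blocks and loops. The whole
program thereby becomes one function of `d` totals and `n × d` uniforms (`simulates_iterARMS`). A
loop invariant computes this function: the accumulators are normalized partial sums, and the
leave-one-out estimator is a combination of the full sums (`loorf_eq`). Sorting the randomness by
coordinate gives `d` independent copies of the iterative procedure, and part (A) exchanges them for
the original sampling. The memory bound is a count, in which sequencing costs only a maximum. -/

namespace ARMS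

/-! ### Gamma laws and the splitting identity. -/

section Gamma

open Set

theorem lintegral_unif (f : ℝ → ENNReal) : ∫⁻ v, f v ∂unif = ∫⁻ v in Ioo 0 1, f v := by
  rw [unif, Measure.restrict_congr_set Ioo_ae_eq_Icc.symm]

theorem lintegral_gamma (k : ℕ) {f : ℝ → ENNReal} (hf : Measurable f) :
    ∫⁻ x, f x ∂gammaMeasure ((k + 1 : ℕ) : ℝ) 1 =
      ∫⁻ x in Ioi 0, ENNReal.ofReal (x ^ k * Real.exp (-x) / k.factorial) * f x := by
  rw [gammaMeasure, lintegral_withDensity_eq_lintegral_mul _ (by unfold gammaPDF; fun_prop) hf,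
    ← lintegral_indicator measurableSet_Ioi]
  refine lintegral_congr_ae ?_
  -- The Gamma density is supported on `x ≥ 0`, the target integral on `x > 0`; they differ by a
  -- null set.
  have h0 : ∀ᵐ x : ℝ, x ≠ 0 := by simp [ae_iff]
  filter_upwards [h0] with x hx
  rcases lt_or_gt_of_ne hx with h | h
  · simp [gammaPDF_of_neg h, h.le]
  · rw [indicator_of_mem (mem_Ioi.2 h), Pi.mul_apply, gammaPDF_of_nonneg h.le]
    congr 2
    have : ((k + 1 : ℕ) : ℝ) - 1 = k := by push_cast; ring
    rw [Real.one_rpow, this, Real.rpow_natCast, Nat.cast_succ, Real.Gamma_nat_eq_factorial, one_mul]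
    ring

instance (k : ℕ) : IsProbabilityMeasure (gammaMeasure ((k + 1 : ℕ) : ℝ) 1) :=
  isProbabilityMeasure_gammaMeasure (by positivity) one_pos

/-- Minus the logarithm of a uniform variable has the standard exponential distribution. -/
theorem unif_map_neg_log :
    unif.map (fun v => -Real.log v) = gammaMeasure ((0 + 1 : ℕ) : ℝ) 1 := by
  refine Measure.ext_of_lintegral _ fun f hf => ?_
  rw [lintegral_map hf (by fun_prop), lintegral_gamma 0 hf, lintegral_unif]
  have him : (fun x => Real.exp (-x)) '' Ioi 0 = Ioo 0 1 := by
    ext v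
    constructor
    · rintro ⟨x, hx, rfl⟩
      exact ⟨Real.exp_pos _, by simpa using hx⟩
    · intro hv
      exact ⟨-Real.log v, by simpa using Real.log_neg hv.1 hv.2, by simp [Real.exp_log hv.1]⟩
  rw [← him, lintegral_image_eq_lintegral_abs_deriv_mul (f' := fun x => -Real.exp (-x))
    measurableSet_Ioi]
  · simp
  · intro x _
    simpa using ((hasDerivAt_neg x).exp).hasDerivWithinAt
  · intro x _ y _ h
    simpa using h

/-- Substitution `y = g v ^ (1 / (k + 1))` on the unit interval. -/
theorem lintegral_mul_rpow_inv (k : ℕ) {g : ℝ} (hg : 0 < g) (f : ℝ → ENNReal) :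
    ∫⁻ v in Ioo 0 1, f (g * v ^ (1 / ((k + 1 : ℕ) : ℝ))) =
      ∫⁻ y in Ioo 0 g, ENNReal.ofReal ((k + 1) * y ^ k / g ^ (k + 1)) * f y := by
  have hroot : ∀ y, 0 < y → g * ((y / g) ^ (k + 1)) ^ (1 / ((k + 1 : ℕ) : ℝ)) = y := by
    intro y hy
    rw [one_div, Real.pow_rpow_inv_natCast (by positivity) (by simp)]
    field_simp
  have him : (fun y => (y / g) ^ (k + 1)) '' Ioo 0 g = Ioo 0 1 := by
    ext v
    constructor
    · rintro ⟨y, hy, rfl⟩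
      have := hy.1
      exact ⟨by positivity, pow_lt_one₀ (by positivity) ((div_lt_one hg).2 hy.2) (by simp)⟩
    · intro hv
      refine ⟨g * v ^ (1 / ((k + 1 : ℕ) : ℝ)), ⟨by have := hv.1; positivity, ?_⟩, ?_⟩
      · have := Real.rpow_lt_one hv.1.le hv.2 (z := 1 / ((k + 1 : ℕ) : ℝ)) (by positivity)
        nlinarith
      · dsimp only
        rw [mul_div_cancel_left₀ _ hg.ne', one_div, Real.rpow_inv_natCast_pow hv.1.le (by simp)]
  rw [← him, lintegral_image_eq_lintegral_abs_deriv_mul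
    (f' := fun y => (k + 1) * y ^ k / g ^ (k + 1)) measurableSet_Ioo]
  · refine setLIntegral_congr_fun measurableSet_Ioo fun y hy => ?_
    have := hy.1
    rw [hroot y hy.1, abs_of_nonneg (by positivity)]
  · intro y _
    refine ((((hasDerivAt_id' y).div_const g).fun_pow (k + 1)).congr_deriv ?_).hasDerivWithinAt
    push_cast
    simp only [div_pow]
    field_simp
    ring
  · intro x hx y hy h
    have := congrArg (fun t => g * t ^ (1 / ((k + 1 : ℕ) : ℝ))) h
    simpa only [hroot x hx.1, hroot y hy.1] using this

/-- Splitting a `Gamma[k+2,1]` variable by an inverse-transform draw gives an independent pair of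
an exponential and a `Gamma[k+1,1]` variable. -/
theorem gamma_split (k : ℕ) :
    ((gammaMeasure ((k + 1 + 1 : ℕ) : ℝ) 1).prod unif).map
        (fun p => (p.1 - p.1 * p.2 ^ (1 / ((k + 1 : ℕ) : ℝ)), p.1 * p.2 ^ (1 / ((k + 1 : ℕ) : ℝ)))) =
      (gammaMeasure ((0 + 1 : ℕ) : ℝ) 1).prod (gammaMeasure ((k + 1 : ℕ) : ℝ) 1) := by
  refine Measure.ext_of_lintegral _ fun f hf => ?_
  rw [lintegral_map hf (by fun_prop), lintegral_prod _ (by fun_prop),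
    lintegral_prod_symm _ hf.aemeasurable, lintegral_gamma (k + 1) (by fun_prop),
    lintegral_gamma k (by fun_prop)]
  -- After substituting `y = g v^(1/(k+1))`, the factor `(k+1)/g^(k+1)` turns `g^(k+1)/(k+1)!` into
  -- `1/k!`, and `exp(-g) = exp(-(g-y)) exp(-y)`. The density is then a product in `(g - y, y)`.
  have hL : ∀ g ∈ Ioi (0 : ℝ),
      ENNReal.ofReal (g ^ (k + 1) * Real.exp (-g) / (k + 1).factorial) *
        ∫⁻ v, f (g - g * v ^ (1 / ((k + 1 : ℕ) : ℝ)), g * v ^ (1 / ((k + 1 : ℕ) : ℝ))) ∂unif =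
      ∫⁻ y, (Ioi (0 : ℝ) ×ˢ Ioi (0 : ℝ)).indicator (fun q : ℝ × ℝ =>
        ENNReal.ofReal (q.2 ^ k * Real.exp (-q.2) / k.factorial * Real.exp (-q.1)) * f q)
          (g - y, y) := by
    intro g hg
    have hg : 0 < g := hg
    rw [lintegral_unif, lintegral_mul_rpow_inv k hg (fun y => f (g - y, y)),
      ← lintegral_const_mul _ (by fun_prop), ← lintegral_indicator measurableSet_Ioo]
    refine lintegral_congr fun y => ?_
    by_cases hy : y ∈ Ioo 0 g
    · rw [indicator_of_mem hy, indicator_of_mem (by simpa using hy.symm), ← mul_assoc,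
        ← ENNReal.ofReal_mul (by positivity)]
      congr 2
      rw [show -(g - y) = -g + y by ring, Real.exp_add, Real.exp_neg y, Nat.factorial_succ]
      push_cast
      field_simp
    · rw [indicator_of_notMem hy, indicator_of_notMem (by simpa using fun h h' => hy ⟨h', h⟩)]
  rw [setLIntegral_congr_fun measurableSet_Ioi hL, ← lintegral_indicator measurableSet_Ioi]
  have hmeas : Measurable ((Ioi (0 : ℝ) ×ˢ Ioi (0 : ℝ)).indicator (fun q : ℝ × ℝ =>
        ENNReal.ofReal (q.2 ^ k * Real.exp (-q.2) / k.factorial * Real.exp (-q.1)) * f q)) :=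
    Measurable.indicator (by fun_prop) (measurableSet_Ioi.prod measurableSet_Ioi)
  -- If `g - y` and `y` are positive, so is `g`. The restriction to `g > 0` is thus automatic, and
  -- after Tonelli the integral over `g` is translation invariant.
  have hdrop : ∀ g : ℝ, (Ioi (0 : ℝ)).indicator (fun g => ∫⁻ y, (Ioi (0 : ℝ) ×ˢ Ioi (0 : ℝ)).indicator
        (fun q : ℝ × ℝ =>
        ENNReal.ofReal (q.2 ^ k * Real.exp (-q.2) / k.factorial * Real.exp (-q.1)) * f q)
          (g - y, y)) g = ∫⁻ y, (Ioi (0 : ℝ) ×ˢ Ioi (0 : ℝ)).indicator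
        (fun q : ℝ × ℝ =>
        ENNReal.ofReal (q.2 ^ k * Real.exp (-q.2) / k.factorial * Real.exp (-q.1)) * f q)
          (g - y, y) := by
    intro g
    by_cases hg : g ∈ Ioi (0 : ℝ)
    · rw [indicator_of_mem hg]
    · rw [indicator_of_notMem hg]
      symm
      rw [lintegral_eq_zero_iff (by fun_prop)]
      refine Filter.Eventually.of_forall fun y => indicator_of_notMem ?_ _
      simp only [mem_prod, mem_Ioi, not_and, not_lt] at hg ⊢
      intro h
      linarith
  rw [lintegral_congr hdrop, lintegral_lintegral_swap (by fun_prop),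
    ← lintegral_indicator measurableSet_Ioi]
  refine lintegral_congr fun y => ?_
  rw [lintegral_sub_right_eq_self (fun x => (Ioi (0 : ℝ) ×ˢ Ioi (0 : ℝ)).indicator
        (fun q : ℝ × ℝ =>
        ENNReal.ofReal (q.2 ^ k * Real.exp (-q.2) / k.factorial * Real.exp (-q.1)) * f q)
          (x, y)) y]
  by_cases hy : y ∈ Ioi (0 : ℝ)
  · have hy' : 0 < y := hy
    rw [indicator_of_mem hy, lintegral_gamma 0 (by fun_prop), ← lintegral_const_mul _ (by fun_prop),
      ← lintegral_indicator measurableSet_Ioi]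
    refine lintegral_congr fun x => ?_
    by_cases hx : x ∈ Ioi (0 : ℝ)
    · rw [indicator_of_mem (mk_mem_prod hx hy), indicator_of_mem hx, ← mul_assoc,
        ← ENNReal.ofReal_mul (by positivity)]
      simp
    · rw [indicator_of_notMem (fun h => hx h.1), indicator_of_notMem hx]
  · rw [indicator_of_notMem hy]
    rw [lintegral_eq_zero_iff (by fun_prop)]
    exact Filter.Eventually.of_forall fun x => indicator_of_notMem (fun h => hy h.2) _

end Gamma

/-! ### Sums of exponentials and the conditional law of a summand. -/

theorem measurable_origE {n : ℕ} : Measurable (origE (n := n)) :=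
  measurable_pi_iff.2 fun s => (Real.measurable_log.comp (measurable_pi_apply s)).neg

theorem map_origE (n : ℕ) :
    (iidUnif n).map origE = Measure.pi fun _ => gammaMeasure ((0 + 1 : ℕ) : ℝ) 1 := by
  have h := Measure.pi_map_pi (ι := Fin n) (μ := fun _ => unif) (f := fun _ v => -Real.log v)
    (fun _ => by fun_prop)
  simp only [unif_map_neg_log] at h
  exact h

theorem map_origE_apply {n : ℕ} (s : Fin n) :
    (iidUnif n).map (fun u => origE u s) = gammaMeasure ((0 + 1 : ℕ) : ℝ) 1 := by
  rw [← unif_map_neg_log, ← (measurePreserving_eval (fun _ : Fin n => unif) s).map_eq,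
    Measure.map_map (by fun_prop) (by fun_prop)]
  rfl

theorem iIndepFun_origE (n : ℕ) :
    iIndepFun (fun (s : Fin n) (u : Fin n → ℝ) => origE u s) (iidUnif n) :=
  iIndepFun_pi (μ := fun _ : Fin n => unif) (X := fun _ v => -Real.log v) fun _ => by fun_prop

/-- The two parts of `gamma_split` add up to the total, so passing to (sum, first part) exhibits the
first part as an inverse-transform draw from the sum. Its first marginal is additivity of Gamma
laws, its disintegration the conditional law. -/
theorem map_prodMk_gamma_split (k : ℕ) :
    ((gammaMeasure ((0 + 1 : ℕ) : ℝ) 1).prod (gammaMeasure ((k + 1 : ℕ) : ℝ) 1)).map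
        (fun q => (q.1 + q.2, q.1)) =
      ((gammaMeasure ((k + 1 + 1 : ℕ) : ℝ) 1).prod unif).map
        (fun p => (p.1, p.1 - p.1 * p.2 ^ (1 / ((k + 1 : ℕ) : ℝ)))) := by
  rw [← gamma_split, Measure.map_map (by fun_prop) (by fun_prop)]
  congr 1
  ext p <;> simp

/-- The sum of an exponential and an independent `Gamma[k+1,1]` variable. -/
theorem gamma_add (k : ℕ) :
    ((gammaMeasure ((0 + 1 : ℕ) : ℝ) 1).prod (gammaMeasure ((k + 1 : ℕ) : ℝ) 1)).map
        (fun q => q.1 + q.2) = gammaMeasure ((k + 1 + 1 : ℕ) : ℝ) 1 := by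
  have h := congrArg (Measure.map Prod.fst) (map_prodMk_gamma_split k)
  rw [Measure.map_map (by fun_prop) (by fun_prop), Measure.map_map (by fun_prop) (by fun_prop)] at h
  refine h.trans ?_
  change Measure.map Prod.fst _ = _
  rw [Measure.map_fst_prod]
  simp

/-- Each further independent exponential raises the shape by one. Arbitrary index sets are allowed
because both the full sum and the tails starting at or after `s` are needed. -/
theorem map_sum_origE {n : ℕ} (k : ℕ) : ∀ A : Finset (Fin n), A.card = k + 1 →
    (iidUnif n).map (fun u => ∑ t ∈ A, origE u t) = gammaMeasure ((k + 1 : ℕ) : ℝ) 1 ∧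
    ∀ s ∉ A, (iidUnif n).map (fun u => (origE u s, ∑ t ∈ A, origE u t)) =
      (gammaMeasure ((0 + 1 : ℕ) : ℝ) 1).prod (gammaMeasure ((k + 1 : ℕ) : ℝ) 1) := by
  have hE : ∀ s, Measurable fun u : Fin n → ℝ => origE u s :=
    fun s => (measurable_pi_apply s).comp measurable_origE
  have hsum : ∀ A : Finset (Fin n), Measurable fun u => ∑ t ∈ A, origE u t :=
    fun A => Finset.measurable_fun_sum _ fun s _ => hE s
  have hpair : ∀ (k : ℕ) (A : Finset (Fin n)),
      (iidUnif n).map (fun u => ∑ t ∈ A, origE u t) = gammaMeasure ((k + 1 : ℕ) : ℝ) 1 →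
      ∀ s ∉ A, (iidUnif n).map (fun u => (origE u s, ∑ t ∈ A, origE u t)) =
        (gammaMeasure ((0 + 1 : ℕ) : ℝ) 1).prod (gammaMeasure ((k + 1 : ℕ) : ℝ) 1) := by
    intro k A hA s hs
    have h := ((iIndepFun_origE n).indepFun_finsetSum_of_notMem hE hs).symm
    have h2 : (∑ j ∈ A, fun u : Fin n → ℝ => origE u j) = fun u => ∑ t ∈ A, origE u t := by
      ext u; simp
    rw [h2, indepFun_iff_map_prod_eq_prod_map_map (hE s).aemeasurable (hsum A).aemeasurable,
      hA, map_origE_apply] at h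
    exact h
  suffices h : ∀ A : Finset (Fin n), A.card = k + 1 →
      (iidUnif n).map (fun u => ∑ t ∈ A, origE u t) = gammaMeasure ((k + 1 : ℕ) : ℝ) 1 from
    fun A hA => ⟨h A hA, hpair k A (h A hA)⟩
  induction k with
  | zero =>
    intro A hA
    obtain ⟨s, rfl⟩ := Finset.card_eq_one.1 hA
    simpa using map_origE_apply s
  | succ k ih =>
    intro A hA
    obtain ⟨s, B, hs, rfl, hB⟩ := Finset.card_eq_succ.1 hA
    have h := hpair k B (ih B hB) s hs
    rw [← gamma_add, ← h, Measure.map_map (by fun_prop) ((hE s).prodMk (hsum B))]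
    congr 1
    ext u
    simp [Finset.sum_insert hs]

theorem measurable_invDraw (n s : ℕ) : Measurable fun p : ℝ × ℝ => invDraw n s p.1 p.2 := by
  unfold invDraw; fun_prop

/-- The conditional law of an inverse-transform draw, as a Markov kernel. -/
noncomputable def invDrawKernel (n s : ℕ) : Kernel ℝ ℝ :=
  (Kernel.id ×ₖ Kernel.const ℝ unif).map fun p => invDraw n s p.1 p.2

theorem invDrawKernel_apply (n s : ℕ) (r : ℝ) :
    invDrawKernel n s r = unif.map (invDraw n s r) := by
  rw [invDrawKernel, Kernel.map_apply _ (measurable_invDraw n s), Kernel.prod_apply,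
    Kernel.id_apply, Kernel.const_apply, Measure.dirac_prod,
    Measure.map_map (measurable_invDraw n s) (by fun_prop)]
  rfl

instance (n s : ℕ) : IsMarkovKernel (invDrawKernel n s) :=
  Kernel.IsMarkovKernel.map _ (measurable_invDraw n s)

theorem compProd_invDrawKernel (n s : ℕ) (μ : Measure ℝ) [SFinite μ] :
    μ ⊗ₘ invDrawKernel n s = (μ.prod unif).map fun p => (p.1, invDraw n s p.1 p.2) := by
  have hm := measurable_invDraw n s
  refine Measure.ext_of_lintegral _ fun f hf => ?_
  rw [Measure.lintegral_compProd hf, lintegral_map hf (by fun_prop),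
    lintegral_prod _ (by fun_prop)]
  refine lintegral_congr fun r => ?_
  rw [invDrawKernel_apply, lintegral_map (by fun_prop) (by fun_prop)]

/-- A conditional distribution is determined almost everywhere by the joint law. The joint law of
the tail sum and `E^{(s)}` comes from the independence of `E^{(s)}` and the strictly later sum,
through `map_prodMk_gamma_split`. -/
theorem condDistrib_origE {n : ℕ} (s : Fin n) (hs : (s : ℕ) + 1 < n) :
    condDistrib (fun u => origE u s) (fun u => ∑ t ∈ Finset.Ici s, origE u t) (iidUnif n)
      =ᵐ[(iidUnif n).map fun u => ∑ t ∈ Finset.Ici s, origE u t]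
        fun r => unif.map (invDraw n ((s : ℕ) + 1) r) := by
  -- With zero-based `s`, exactly `k + 1 = n - (s + 1)` summands come strictly later; this is the
  -- denominator of the exponent in `invDraw`.
  obtain ⟨k, hk⟩ : ∃ k, n = s + 2 + k := ⟨n - (s + 2), by omega⟩
  have hE : ∀ s, Measurable fun u : Fin n → ℝ => origE u s :=
    fun s => (measurable_pi_apply s).comp measurable_origE
  have hsum : ∀ A : Finset (Fin n), Measurable fun u => ∑ t ∈ A, origE u t :=
    fun A => Finset.measurable_fun_sum _ fun s _ => hE s
  have hcard : (Finset.Ioi s).card = k + 1 := by rw [Fin.card_Ioi]; omega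
  have hcard' : (Finset.Ici s).card = k + 1 + 1 := by rw [Fin.card_Ici]; omega
  have hIci : ∀ u : Fin n → ℝ,
      ∑ t ∈ Finset.Ici s, origE u t = origE u s + ∑ t ∈ Finset.Ioi s, origE u t := by
    intro u
    rw [← Finset.Ioi_insert s, Finset.sum_insert (by simp)]
  have key : condDistrib (fun u => origE u s) (fun u => ∑ t ∈ Finset.Ici s, origE u t)
      (iidUnif n) =ᵐ[(iidUnif n).map fun u => ∑ t ∈ Finset.Ici s, origE u t]
        invDrawKernel n ((s : ℕ) + 1) := by
    refine condDistrib_ae_eq_of_measure_eq_compProd _ (hE s).aemeasurable ?_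
    rw [(map_sum_origE (k + 1) _ hcard').1, compProd_invDrawKernel]
    have h := congrArg (Measure.map fun q : ℝ × ℝ => (q.1 + q.2, q.1))
      ((map_sum_origE k _ hcard).2 s (by simp))
    rw [map_prodMk_gamma_split, Measure.map_map (by fun_prop) ((hE s).prodMk (hsum _))] at h
    have hexp : ((n : ℕ) : ℝ) - ((s + 1 : ℕ) : ℝ) = ((k + 1 : ℕ) : ℝ) := by
      have : (n : ℝ) = s + 2 + k := by exact_mod_cast hk
      rw [this]; push_cast; ring
    simp only [invDraw, hexp]
    rw [← h]
    congr 1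
    ext u <;> simp [hIci]
  filter_upwards [key] with r hr
  rw [hr, invDrawKernel_apply]

/-! ### The iterative procedure produces i.i.d. exponentials. -/

theorem sum_iterE_eq_total (n : ℕ) (hn : 1 ≤ n) (p : ℝ × (Fin (n - 1) → ℝ)) :
    ∑ s, iterE (n := n) p s = p.1 := by
  obtain ⟨m, rfl⟩ : ∃ m, n = m + 1 := ⟨n - 1, by omega⟩
  -- The draws telescope, and the last round takes all that remains.
  have h : ∀ k, ∑ j ∈ Finset.range k, iterDraw (m + 1) p.2 j (iterRem (m + 1) p.1 p.2 j) =
      p.1 - iterRem (m + 1) p.1 p.2 k := by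
    intro k
    induction k with
    | zero => simp [iterRem]
    | succ k ih => rw [Finset.sum_range_succ, ih, iterRem]; ring
  have h2 := h (m + 1)
  rw [← Fin.sum_univ_eq_sum_range
    (fun j => iterDraw (m + 1) p.2 j (iterRem (m + 1) p.1 p.2 j))] at h2
  refine h2.trans ?_
  simp [iterRem, iterDraw]

theorem measurable_iterDraw (n k : ℕ) :
    Measurable fun q : ℝ × (Fin (n - 1) → ℝ) => iterDraw n q.2 k q.1 := by
  unfold iterDraw
  split_ifs with h
  · have := measurable_invDraw n (k + 1)
    exact this.comp (measurable_fst.prodMk ((measurable_pi_apply _).comp measurable_snd))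
  · exact measurable_fst

theorem measurable_iterRem (n k : ℕ) :
    Measurable fun p : ℝ × (Fin (n - 1) → ℝ) => iterRem n p.1 p.2 k := by
  induction k with
  | zero => exact measurable_fst
  | succ k ih => exact ih.sub ((measurable_iterDraw n k).comp (ih.prodMk measurable_snd))

theorem measurable_iterE {n : ℕ} : Measurable (iterE (n := n)) :=
  measurable_pi_iff.2 fun s =>
    (measurable_iterDraw n s).comp ((measurable_iterRem n s).prodMk measurable_snd)

theorem pi_fin_succ {α : Type*} [MeasurableSpace α] (μ : Measure α) [SigmaFinite μ] (m : ℕ) :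
    Measure.pi (fun _ : Fin (m + 1) => μ) =
      (μ.prod (Measure.pi fun _ : Fin m => μ)).map
        (fun p => (Fin.cons p.1 p.2 : Fin (m + 1) → α)) := by
  rw [← (measurePreserving_piFinSuccAbove (fun _ : Fin (m + 1) => μ) 0).symm.map_eq]
  change Measure.map (fun p : α × (Fin m → α) =>
    (Fin.insertNth 0 p.1 p.2 : Fin (m + 1) → α)) _ = _
  simp only [Fin.insertNth_zero']

theorem measurable_fin_snoc {α : Type*} [MeasurableSpace α] (m : ℕ) :
    Measurable fun p : (Fin m → α) × α => (Fin.snoc p.1 p.2 : Fin (m + 1) → α) := by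
  refine measurable_pi_iff.2 fun i => ?_
  cases i using Fin.lastCases with
  | last => simpa using measurable_snd
  | cast i => simp only [Fin.snoc_castSucc]; fun_prop

theorem pi_fin_succ_last {α : Type*} [MeasurableSpace α] (μ : Measure α) [SigmaFinite μ] (m : ℕ) :
    Measure.pi (fun _ : Fin (m + 1) => μ) =
      ((Measure.pi fun _ : Fin m => μ).prod μ).map
        (fun p => (Fin.snoc p.1 p.2 : Fin (m + 1) → α)) := by
  rw [← Measure.prod_swap, Measure.map_map (measurable_fin_snoc m) measurable_swap,
    ← (measurePreserving_piFinSuccAbove (fun _ : Fin (m + 1) => μ) (Fin.last m)).symm.map_eq]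
  change Measure.map (fun p : α × (Fin m → α) =>
    (Fin.insertNth (Fin.last m) p.1 p.2 : Fin (m + 1) → α)) _ = _
  simp only [Fin.insertNth_last']
  rfl

theorem measurable_fin_cons {α : Type*} [MeasurableSpace α] (m : ℕ) :
    Measurable fun p : α × (Fin m → α) => (Fin.cons p.1 p.2 : Fin (m + 1) → α) := by
  refine measurable_pi_iff.2 fun i => ?_
  cases i using Fin.cases with
  | zero => simpa using measurable_fst
  | succ i => simp only [Fin.cons_succ]; fun_prop

/-- The exponent depends only on the difference of the sample count and the round number. After one
round the procedure is therefore the shorter procedure restarted from the remaining sum. -/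
theorem iterRem_cons (m : ℕ) (T v₀ : ℝ) (v : Fin m → ℝ) (k : ℕ) :
    iterRem (m + 2) T (Fin.cons v₀ v : Fin (m + 1) → ℝ) (k + 1) =
        iterRem (m + 1) (T * v₀ ^ (1 / ((m + 1 : ℕ) : ℝ))) v k ∧
    iterDraw (m + 2) (Fin.cons v₀ v : Fin (m + 1) → ℝ) (k + 1) = iterDraw (m + 1) v k := by
  have hdraw : ∀ k, iterDraw (m + 2) (Fin.cons v₀ v : Fin (m + 1) → ℝ) (k + 1) =
      iterDraw (m + 1) v k := by
    intro k
    ext r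
    unfold iterDraw
    by_cases h : k < m
    · have h' : k + 1 < m + 2 - 1 := by omega
      have hexp : ((m + 2 : ℕ) : ℝ) - ((k + 1 + 1 : ℕ) : ℝ) = ((m + 1 : ℕ) : ℝ) - (k + 1 : ℕ) := by
        push_cast; ring
      rw [dif_pos h', dif_pos (by simpa using h), invDraw, invDraw, hexp]
      rfl
    · rw [dif_neg (by omega), dif_neg (by omega)]
  refine ⟨?_, hdraw k⟩
  induction k with
  | zero =>
    have hexp : ((m + 2 : ℕ) : ℝ) - ((0 + 1 : ℕ) : ℝ) = ((m + 1 : ℕ) : ℝ) := by push_cast; ring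
    simp only [iterRem, iterDraw]
    rw [dif_pos (by simp), invDraw, hexp]
    simp
  | succ k ih => rw [iterRem, ih, hdraw, iterRem]

theorem iterE_cons (m : ℕ) (T v₀ : ℝ) (v : Fin m → ℝ) :
    iterE (n := m + 2) (T, (Fin.cons v₀ v : Fin (m + 1) → ℝ)) =
      Fin.cons (T - T * v₀ ^ (1 / ((m + 1 : ℕ) : ℝ)))
        (iterE (n := m + 1) (T * v₀ ^ (1 / ((m + 1 : ℕ) : ℝ)), v)) := by
  ext i
  cases i using Fin.cases with
  | zero =>
    have hexp : ((m + 2 : ℕ) : ℝ) - ((0 + 1 : ℕ) : ℝ) = ((m + 1 : ℕ) : ℝ) := by push_cast; ring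
    simp only [iterE, iterDraw, Fin.cons_zero, Fin.val_zero, iterRem]
    rw [dif_pos (by simp), invDraw, hexp]
    rfl
  | succ i =>
    have h := iterRem_cons m T v₀ v i
    simp only [iterE, Fin.cons_succ, Fin.val_succ, h.1, h.2]

theorem map_iterE_succ (m : ℕ) :
    (iterSource (m + 1)).map (iterE (n := m + 1)) =
      Measure.pi fun _ => gammaMeasure ((0 + 1 : ℕ) : ℝ) 1 := by
  induction m with
  | zero =>
    have h : (iterE (n := 0 + 1)) = (fun (x : ℝ) (_ : Fin 1) => x) ∘ Prod.fst := by
      ext p s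
      fin_cases s
      simp [iterE, iterDraw, iterRem]
    rw [h, ← Measure.map_map (by fun_prop) measurable_fst, iterSource, Measure.map_fst_prod,
      measure_univ, one_smul]
    exact (measurePreserving_piUnique
      (fun _ : Fin 1 => gammaMeasure ((0 + 1 : ℕ) : ℝ) 1)).symm.map_eq
  | succ m ih =>
    have hcons := measurable_fin_cons (α := ℝ) m
    have hcons' := measurable_fin_cons (α := ℝ) (m + 1)
    have hE := measurable_iterE (n := m + 1)
    have hE' := measurable_iterE (n := m + 1 + 1)
    rw [pi_fin_succ, ← ih, iterSource, iterSource]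
    have hiid : iidUnif (m + 1 + 1 - 1) = _ := pi_fin_succ unif m
    set γ₂ := gammaMeasure ((m + 1 + 1 : ℕ) : ℝ) 1
    set γ₁ := gammaMeasure ((m + 1 : ℕ) : ℝ) 1
    set γ₀ := gammaMeasure ((0 + 1 : ℕ) : ℝ) 1
    set π : Measure (Fin m → ℝ) := Measure.pi fun _ => unif
    have hπ : iidUnif (m + 1 - 1) = π := rfl
    set split : ℝ × ℝ → ℝ × ℝ := fun p =>
      (p.1 - p.1 * p.2 ^ (1 / ((m + 1 : ℕ) : ℝ)), p.1 * p.2 ^ (1 / ((m + 1 : ℕ) : ℝ))) with hs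
    have hsm : Measurable split := by fun_prop
    have hassoc := (measurePreserving_prodAssoc γ₂ unif π).map_eq
    have hassoc' := (measurePreserving_prodAssoc γ₀ γ₁ π).map_eq
    -- The induction uses the splitting identity only here; the remaining steps reassociate products
    -- until both sides are images of `(γ₂.prod unif).prod π`, where `iterE_cons` identifies the two
    -- maps.
    have hsplit : (γ₀.prod γ₁).prod π = ((γ₂.prod unif).prod π).map (Prod.map split id) := by
      rw [← Measure.map_prod_map _ _ hsm measurable_id, gamma_split, Measure.map_id]
    have hL : γ₂.prod ((unif.prod π).map fun p => (Fin.cons p.1 p.2 : Fin (m + 1) → ℝ)) =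
        (γ₂.prod (unif.prod π)).map
          (Prod.map id fun p => (Fin.cons p.1 p.2 : Fin (m + 1) → ℝ)) := by
      rw [← Measure.map_prod_map _ _ measurable_id hcons, Measure.map_id]
    have hR : γ₀.prod ((γ₁.prod π).map (iterE (n := m + 1))) =
        (γ₀.prod (γ₁.prod π)).map (Prod.map id (iterE (n := m + 1))) := by
      rw [← Measure.map_prod_map _ _ measurable_id hE, Measure.map_id]
    rw [hiid, hπ, hL, hR, ← hassoc, ← hassoc', hsplit,
      Measure.map_map (measurable_id.prodMap hcons) (MeasurableEquiv.measurable _),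
      Measure.map_map hE' (by fun_prop),
      Measure.map_map (MeasurableEquiv.measurable _) (by fun_prop),
      Measure.map_map (measurable_id.prodMap hE) (by fun_prop),
      Measure.map_map hcons' (by fun_prop)]
    congr 1
    ext1 p
    exact iterE_cons m p.1.1 p.1.2 p.2

theorem map_iterE (n : ℕ) (hn : 1 ≤ n) :
    (iterSource n).map (iterE (n := n)) = (iidUnif n).map origE := by
  obtain ⟨m, rfl⟩ : ∃ m, n = m + 1 := ⟨n - 1, by omega⟩
  rw [map_iterE_succ, map_origE]

/-! ### Transfer to the Dirichlet and copula vectors. -/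

/-- Division of a vector by the sum of its entries. -/
noncomputable def normalize {n : ℕ} (x : Fin n → ℝ) (s : Fin n) : ℝ := x s / ∑ t, x t

theorem measurable_normalize {n : ℕ} : Measurable (normalize (n := n)) := by
  unfold normalize; fun_prop

theorem measurable_copula {n : ℕ} : Measurable (copula (n := n)) := by
  unfold copula; fun_prop

theorem origDir_eq_normalize {n : ℕ} (u : Fin n → ℝ) : origDir u = normalize (origE u) := by
  ext s
  simp [origDir, normalize, origE, Finset.sum_neg_distrib, neg_div_neg_eq]

theorem iterDir_eq_normalize {n : ℕ} (hn : 1 ≤ n) (p : ℝ × (Fin (n - 1) → ℝ)) :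
    iterDir (n := n) p = normalize (iterE (n := n) p) := by
  ext s
  rw [iterDir, normalize, sum_iterE_eq_total n hn]

theorem map_iterDir (n : ℕ) (hn : 1 ≤ n) :
    (iterSource n).map (iterDir (n := n)) = (iidUnif n).map origDir := by
  have h1 : iterDir (n := n) = normalize ∘ iterE (n := n) := funext (iterDir_eq_normalize hn)
  have h2 : origDir (n := n) = normalize ∘ origE := funext origDir_eq_normalize
  rw [h1, h2, ← Measure.map_map measurable_normalize measurable_iterE,
    ← Measure.map_map measurable_normalize measurable_origE, map_iterE n hn]

theorem measurable_origDir {n : ℕ} : Measurable (origDir (n := n)) := by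
  rw [show origDir (n := n) = normalize ∘ origE from funext origDir_eq_normalize]
  exact measurable_normalize.comp measurable_origE

theorem measurable_iterDir {n : ℕ} : Measurable (iterDir (n := n)) :=
  measurable_pi_iff.2 fun s =>
    ((measurable_pi_apply s).comp measurable_iterE).div measurable_fst

theorem map_copula_iterDir (n : ℕ) (hn : 1 ≤ n) :
    (iterSource n).map (fun p => copula (iterDir (n := n) p)) =
      (iidUnif n).map (fun u => copula (origDir u)) := by
  have h := congrArg (Measure.map copula) (map_iterDir n hn)
  rwa [Measure.map_map measurable_copula measurable_iterDir,
    Measure.map_map measurable_copula measurable_origDir] at h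

/-! ### Simulating kernels by functions of views and independent randomness. -/

/-- The part of a machine state that survives a step of the program: for every coordinate the
contents of its vector registers, and the scalars `n`, `s`, `j`, `meanJ`. -/
abbrev View (d : ℕ) : Type := (Fin d → VecName → ℝ) × ℝ × ℝ × ℝ × ℝ

/-- The view of a machine state. -/
def view {d : ℕ} (σ : Reg d → ℝ) : View d :=
  (fun i a => σ (V a i), σ (S .n), σ (S .s), σ (S .j), σ (S .meanJ))

theorem measurable_view {d : ℕ} : Measurable (view (d := d)) := by
  unfold view; fun_prop

/-- Started in a state with `n` samples, the kernel acts on views as the function `F` applied to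
the view and to randomness of law `μ`. -/
structure Simulates {d : ℕ} {Ω : Type} [MeasurableSpace Ω] (n : ℕ)
    (κ : Kernel (Reg d → ℝ) (Reg d → ℝ)) (μ : Measure Ω) (F : View d → Ω → View d) : Prop where
  measurable : Measurable fun q : View d × Ω => F q.1 q.2
  preserves : ∀ a ω, a.2.1 = (n : ℝ) → (F a ω).2.1 = (n : ℝ)
  map_view : ∀ σ, σ (S .n) = (n : ℝ) → (κ σ).map view = μ.map (F (view σ))

namespace Simulates

variable {d n : ℕ} {Ω Ω' : Type} [MeasurableSpace Ω] [MeasurableSpace Ω']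
  {κ κ' : Kernel (Reg d → ℝ) (Reg d → ℝ)} {μ : Measure Ω} {μ' : Measure Ω'}
  {F : View d → Ω → View d} {F' : View d → Ω' → View d}

theorem measurable_apply (h : Simulates n κ μ F) (a : View d) : Measurable (F a) :=
  h.measurable.comp (measurable_const.prodMk measurable_id)

/-- The law of the second view depends on the intermediate state only through its view, so the
forgotten registers can be integrated out and the two sources of randomness are independent. -/
theorem comp [SFinite μ] [SFinite μ'] (h : Simulates n κ μ F) (h' : Simulates n κ' μ' F') :
    Simulates n (κ' ∘ₖ κ) (μ.prod μ') fun a ω => F' (F a ω.1) ω.2 := by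
  have hm := h.measurable
  have hm' := h'.measurable
  have hFF : Measurable fun q : View d × Ω × Ω' => F' (F q.1 q.2.1) q.2.2 :=
    hm'.comp ((hm.comp (measurable_fst.prodMk measurable_snd.fst)).prodMk measurable_snd.snd)
  refine ⟨hFF, fun a ω ha => h'.preserves _ _ (h.preserves _ _ ha), fun σ hσ => ?_⟩
  refine Measure.ext_of_lintegral _ fun f hf => ?_
  have hG : Measurable fun a => ∫⁻ ω, f (F' a ω) ∂μ' :=
    Measurable.lintegral_prod_right' (f := fun q : View d × Ω' => f (F' q.1 q.2)) (hf.comp hm')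
  -- The second simulation is available only in states that hold `n` samples; `preserves` makes this
  -- hold almost surely after the first command.
  have hae : ∀ᵐ τ ∂κ σ, τ (S .n) = (n : ℝ) := by
    have hs : MeasurableSet {a : View d | a.2.1 = (n : ℝ)} :=
      measurableSet_eq_fun (by fun_prop) measurable_const
    have h0 : ∀ᵐ a ∂(κ σ).map view, a.2.1 = (n : ℝ) := by
      rw [h.map_view σ hσ, ae_map_iff (h.measurable_apply _).aemeasurable hs]
      exact Filter.Eventually.of_forall fun ω => h.preserves _ _ hσ
    exact ae_of_ae_map measurable_view.aemeasurable h0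
  have hfv : Measurable fun τ : Reg d → ℝ => f (view τ) := hf.comp measurable_view
  have hFa : Measurable fun ω : Ω × Ω' => F' (F (view σ) ω.1) ω.2 :=
    hFF.comp (measurable_const.prodMk measurable_id)
  rw [lintegral_map hf measurable_view, Kernel.lintegral_comp _ _ _ hfv, lintegral_map hf hFa,
    lintegral_prod (fun ω : Ω × Ω' => f (F' (F (view σ) ω.1) ω.2)) (hf.comp hFa).aemeasurable]
  calc ∫⁻ τ, ∫⁻ x, f (view x) ∂κ' τ ∂κ σ
      = ∫⁻ τ, ∫⁻ ω, f (F' (view τ) ω) ∂μ' ∂κ σ := by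
        refine lintegral_congr_ae ?_
        filter_upwards [hae] with τ hτ
        rw [← lintegral_map hf measurable_view, h'.map_view τ hτ,
          lintegral_map hf (h'.measurable_apply _)]
    _ = ∫⁻ a, ∫⁻ ω, f (F' a ω) ∂μ' ∂(κ σ).map view := by
        rw [lintegral_map hG measurable_view]
    _ = _ := by rw [h.map_view σ hσ, lintegral_map hG (h.measurable_apply _)]

theorem of_measurePreserving {φ : Ω' → Ω} (hφ : MeasurePreserving φ μ' μ)
    (hF : Measurable fun q : View d × Ω => F q.1 q.2)
    (hp : ∀ a ω, a.2.1 = (n : ℝ) → (F a ω).2.1 = (n : ℝ))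
    (h : Simulates n κ μ' fun a ω => F a (φ ω)) : Simulates n κ μ F := by
  refine ⟨hF, hp, fun σ hσ => ?_⟩
  have hFa : Measurable (F (view σ)) := hF.comp (measurable_const.prodMk measurable_id)
  rw [h.map_view σ hσ, ← hφ.map_eq, Measure.map_map hFa hφ.measurable]
  rfl

/-- A step that ignores its randomness may be given any other probability source, such as an empty
product or a product of point masses. -/
theorem of_const [IsProbabilityMeasure μ] [IsProbabilityMeasure μ'] {f : View d → View d}
    [Nonempty Ω] (h : Simulates n κ μ fun a _ => f a) : Simulates n κ μ' fun a _ => f a := by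
  have hf : Measurable f := h.measurable.comp (measurable_id.prodMk
    (measurable_const (a := Classical.arbitrary Ω)))
  refine ⟨hf.comp measurable_fst, fun a _ => h.preserves a (Classical.arbitrary Ω), fun σ hσ => ?_⟩
  rw [h.map_view σ hσ]
  simp [Measure.map_const]

theorem comp_const [IsProbabilityMeasure μ] {f : View d → View d} (h : Simulates n κ μ F)
    (h' : Simulates n κ' (Measure.dirac ()) fun a _ => f a) :
    Simulates n (κ' ∘ₖ κ) μ fun a ω => f (F a ω) := by
  have hf : Measurable f := h'.measurable.comp (measurable_id.prodMk (measurable_const (a := ())))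
  exact of_measurePreserving (measurePreserving_fst (μ := μ) (ν := Measure.dirac ()))
    (hf.comp h.measurable) (fun a ω ha => h'.preserves _ () (h.preserves _ _ ha)) (h.comp h')

theorem const_comp [IsProbabilityMeasure μ'] {f : View d → View d}
    (h : Simulates n κ (Measure.dirac ()) fun a _ => f a) (h' : Simulates n κ' μ' F') :
    Simulates n (κ' ∘ₖ κ) μ' fun a ω => F' (f a) ω := by
  have hf : Measurable f := h.measurable.comp (measurable_id.prodMk (measurable_const (a := ())))
  exact of_measurePreserving (measurePreserving_snd (μ := Measure.dirac ()) (ν := μ'))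
    (h'.measurable.comp ((hf.comp measurable_fst).prodMk measurable_snd))
    (fun a ω ha => h'.preserves _ _ (h.preserves _ () ha)) (h.comp h')

theorem of_map {G : (Reg d → ℝ) → Ω → Reg d → ℝ} (hG : ∀ σ, Measurable (G σ))
    (hκ : ∀ σ, σ (S .n) = (n : ℝ) → κ σ = μ.map (G σ))
    (hF : Measurable fun q : View d × Ω => F q.1 q.2)
    (hp : ∀ a ω, a.2.1 = (n : ℝ) → (F a ω).2.1 = (n : ℝ))
    (hGF : ∀ σ ω, view (G σ ω) = F (view σ) ω) : Simulates n κ μ F := by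
  refine ⟨hF, hp, fun σ hσ => ?_⟩
  rw [hκ σ hσ, Measure.map_map measurable_view (hG σ)]
  congr 1
  ext1 ω
  exact hGF σ ω

theorem of_dirac {g : (Reg d → ℝ) → Reg d → ℝ} {f : View d → View d}
    (hκ : ∀ σ, κ σ = Measure.dirac (g σ)) (hf : Measurable f)
    (hp : ∀ a, a.2.1 = (n : ℝ) → (f a).2.1 = (n : ℝ)) (hgf : ∀ σ, view (g σ) = f (view σ)) :
    Simulates n κ (Measure.dirac ()) fun a _ => f a := by
  refine of_map (G := fun σ _ => g σ) (fun σ => measurable_const) (fun σ _ => ?_)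
    (hf.comp measurable_fst) (fun a _ => hp a) (fun σ _ => hgf σ)
  rw [hκ, Measure.map_const]
  simp

theorem id : Simulates (d := d) n Kernel.id (Measure.dirac ()) fun a _ => a :=
  of_dirac (g := fun σ => σ) (fun σ => Kernel.id_apply σ) measurable_id (fun _ ha => ha)
    (fun _ => rfl)

end Simulates

/-- Apply the coordinate maps `h` at the coordinates `e 0, e 1, …` in turn. -/
def foldCoord {d : ℕ} {Ω : Type} (h : ℝ × ℝ × ℝ × ℝ → (VecName → ℝ) → Ω → VecName → ℝ) :
    (m : ℕ) → (Fin m → Fin d) → View d → (Fin m → Ω) → View d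
  | 0, _, a, _ => a
  | m + 1, e, a, ω => foldCoord h m (fun k => e k.succ)
      (Function.update a.1 (e 0) (h a.2 (a.1 (e 0)) (ω 0)), a.2) (fun k => ω k.succ)

theorem foldCoord_snd {d : ℕ} {Ω : Type} (h : ℝ × ℝ × ℝ × ℝ → (VecName → ℝ) → Ω → VecName → ℝ)
    (m : ℕ) (e : Fin m → Fin d) (a : View d) (ω : Fin m → Ω) :
    (foldCoord h m e a ω).2 = a.2 := by
  induction m generalizing a with
  | zero => rfl
  | succ m ih => rw [foldCoord, ih]

/-- Each step reads and writes only its own coordinate, besides reading the unchanged scalars. When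
no coordinate is visited twice, sequential updates therefore agree with simultaneous ones. -/
theorem foldCoord_fst {d : ℕ} {Ω : Type} (h : ℝ × ℝ × ℝ × ℝ → (VecName → ℝ) → Ω → VecName → ℝ)
    (m : ℕ) (e : Fin m → Fin d) (he : Function.Injective e) (a : View d) (ω : Fin m → Ω) :
    (∀ k, (foldCoord h m e a ω).1 (e k) = h a.2 (a.1 (e k)) (ω k)) ∧
      ∀ i ∉ Set.range e, (foldCoord h m e a ω).1 i = a.1 i := by
  induction m generalizing a with
  | zero => exact ⟨fun k => k.elim0, fun i _ => rfl⟩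
  | succ m ih =>
    have he' : Function.Injective fun k : Fin m => e k.succ := he.comp (Fin.succ_injective m)
    obtain ⟨h1, h2⟩ := ih _ he' (Function.update a.1 (e 0) (h a.2 (a.1 (e 0)) (ω 0)), a.2)
      (fun k => ω k.succ)
    refine ⟨fun k => ?_, fun i hi => ?_⟩
    · cases k using Fin.cases with
      | zero =>
        rw [foldCoord, h2]
        · simp
        · rintro ⟨k, hk⟩
          exact Fin.succ_ne_zero k (he hk)
      | succ k =>
        rw [foldCoord, h1]
        simp [Function.update_of_ne (he.ne (Fin.succ_ne_zero k))]
    · rw [foldCoord, h2 i fun ⟨k, hk⟩ => hi ⟨_, hk⟩]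
      exact Function.update_of_ne (fun hi0 => hi ⟨0, hi0.symm⟩) _ _

/-- A general enumeration `e` is used so that the induction can pass to its tail. -/
theorem simulates_block_ofFn {d n : ℕ} {Ω : Type} [MeasurableSpace Ω] {μ : Measure Ω}
    [IsProbabilityMeasure μ] (J : (Fin d → Bool) → ℝ)
    {c : Fin d → Cmd (Reg d) d} {h : ℝ × ℝ × ℝ × ℝ → (VecName → ℝ) → Ω → VecName → ℝ}
    (hc : ∀ i, Simulates n ((c i).run J) μ
      fun a ω => (Function.update a.1 i (h a.2 (a.1 i) ω), a.2)) (m : ℕ) (e : Fin m → Fin d) :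
    Simulates n ((Cmd.block (List.ofFn fun k => c (e k))).run J) (Measure.pi fun _ : Fin m => μ)
      (foldCoord h m e) := by
  induction m with
  | zero => exact Simulates.id.of_const
  | succ m ih =>
    have hh := (hc (e 0)).comp (ih fun k => e k.succ)
    rw [List.ofFn_succ]
    have hcons := measurable_fin_cons (α := Ω) m
    have hmeas : Measurable fun q : View d × (Fin (m + 1) → Ω) =>
        foldCoord h (m + 1) e q.1 q.2 := by
      refine hh.measurable.comp (f := fun q : View d × (Fin (m + 1) → Ω) =>
        (q.1, q.2 0, fun k : Fin m => q.2 k.succ)) ?_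
      fun_prop
    refine Simulates.of_measurePreserving (φ := fun p : Ω × (Fin m → Ω) => Fin.cons p.1 p.2)
      ⟨hcons, (pi_fin_succ μ m).symm⟩ hmeas (fun a ω ha => ?_) ?_
    · rw [foldCoord_snd, ha]
    · exact hh

/-- A program that treats every coordinate in the same way, with its own randomness. -/
theorem simulates_forDim {d n : ℕ} {Ω : Type} [MeasurableSpace Ω] {μ : Measure Ω}
    [IsProbabilityMeasure μ] (J : (Fin d → Bool) → ℝ)
    {c : Fin d → Cmd (Reg d) d} {h : ℝ × ℝ × ℝ × ℝ → (VecName → ℝ) → Ω → VecName → ℝ}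
    (hc : ∀ i, Simulates n ((c i).run J) μ
      fun a ω => (Function.update a.1 i (h a.2 (a.1 i) ω), a.2)) :
    Simulates n ((Cmd.forDim c).run J) (Measure.pi fun _ : Fin d => μ)
      fun a ω => (fun i => h a.2 (a.1 i) (ω i), a.2) := by
  have hh := simulates_block_ofFn J hc d fun k => k
  rw [List.ofFn_eq_map] at hh
  have heq : foldCoord h d (fun k => k) = fun a ω => (fun i => h a.2 (a.1 i) (ω i), a.2) := by
    funext a ω
    refine Prod.ext ?_ (foldCoord_snd h d _ a ω)
    funext i
    exact (foldCoord_fst h d (fun k => k) Function.injective_id a ω).1 i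
  rwa [heq] at hh

theorem simulates_forDim_const {d n : ℕ} (J : (Fin d → Bool) → ℝ)
    {c : Fin d → Cmd (Reg d) d} {h : ℝ × ℝ × ℝ × ℝ → (VecName → ℝ) → VecName → ℝ}
    (hc : ∀ i, Simulates n ((c i).run J) (Measure.dirac ())
      fun a _ => (Function.update a.1 i (h a.2 (a.1 i)), a.2)) :
    Simulates n ((Cmd.forDim c).run J) (Measure.dirac ())
      fun a _ => (fun i => h a.2 (a.1 i), a.2) :=
  Simulates.of_const (simulates_forDim (h := fun p v _ => h p v) J hc)

/-- The view with a new value of the loop counter. -/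
def setCounter {d : ℕ} (a : View d) (t : ℝ) : View d := (a.1, a.2.1, t, a.2.2.2)

/-- The rounds of a loop, on views. -/
def loopView {d : ℕ} {Ω : Type} (F : View d → Ω → View d) :
    (m : ℕ) → View d → (Fin m → Ω) → View d
  | 0, a, _ => a
  | m + 1, a, ω => F (setCounter (loopView F m a fun k => ω k.castSucc) ((m + 1 : ℕ) : ℝ))
      (ω (Fin.last m))

theorem simulates_rounds {d n : ℕ} {Ω : Type} [MeasurableSpace Ω] {μ : Measure Ω}
    [IsProbabilityMeasure μ] {κ : Kernel (Reg d → ℝ) (Reg d → ℝ)} {F : View d → Ω → View d}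
    (h : Simulates n κ μ F) (m : ℕ) :
    Simulates n (rounds (S .s) κ m) (Measure.pi fun _ : Fin m => μ) (loopView F m) := by
  induction m with
  | zero => exact Simulates.id.of_const
  | succ m ih =>
    have hset : Simulates (d := d) n (storeFun (S .s) (fun _ => ((m + 1 : ℕ) : ℝ)) measurable_const)
        (Measure.dirac ()) fun a _ => setCounter a ((m + 1 : ℕ) : ℝ) := by
      refine Simulates.of_dirac
        (g := fun σ => Function.update σ (S .s) ((m + 1 : ℕ) : ℝ))
        (fun σ => Kernel.deterministic_apply _ σ) (by unfold setCounter; fun_prop)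
        (fun a ha => ha) (fun σ => ?_)
      simp [view, setCounter]
    have hh := (ih.comp_const hset).comp h
    have hsnoc := measurable_fin_snoc (α := Ω) m
    have hmeas : Measurable fun q : View d × (Fin (m + 1) → Ω) => loopView F (m + 1) q.1 q.2 := by
      refine hh.measurable.comp (f := fun q : View d × (Fin (m + 1) → Ω) =>
        (q.1, (fun k : Fin m => q.2 k.castSucc), q.2 (Fin.last m))) ?_
      fun_prop
    refine Simulates.of_measurePreserving (φ := fun p : (Fin m → Ω) × Ω => Fin.snoc p.1 p.2)
      ⟨hsnoc, (pi_fin_succ_last μ m).symm⟩ hmeas (fun a ω ha => ?_) ?_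
    · exact h.preserves _ _ (ih.preserves _ _ ha)
    · simp only [loopView, Fin.snoc_castSucc, Fin.snoc_last]
      rw [rounds, Kernel.comp_assoc]
      exact hh

theorem simulates_loop {d n : ℕ} {Ω : Type} [MeasurableSpace Ω] {μ : Measure Ω}
    [IsProbabilityMeasure μ] (J : (Fin d → Bool) → ℝ) {c : Cmd (Reg d) d}
    {F : View d → Ω → View d} (h : Simulates n (c.run J) μ F) :
    Simulates n ((Cmd.loop (S .s) (S .n) c).run J) (Measure.pi fun _ : Fin n => μ)
      (loopView F n) := by
  have hr := simulates_rounds h n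
  refine ⟨hr.measurable, hr.preserves, fun σ hσ => ?_⟩
  rw [← hr.map_view σ hσ]
  change Measure.map view (rounds (S .s) (c.run J) ⌊σ (S .n)⌋₊ σ) = _
  rw [hσ, Nat.floor_natCast]

theorem storeKernel_apply {ι : Type} [DecidableEq ι] (x : ι) (κ : Kernel (ι → ℝ) ℝ)
    [IsSFiniteKernel κ] (σ : ι → ℝ) :
    storeKernel x κ σ = (κ σ).map (Function.update σ x) := by
  have hu : Measurable fun p : (ι → ℝ) × ℝ => Function.update p.1 x p.2 := by
    refine measurable_pi_iff.2 fun y => ?_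
    by_cases h : y = x
    · subst h; simpa using measurable_snd
    · simp only [Function.update_of_ne h]; fun_prop
  rw [storeKernel, Kernel.map_apply _ hu, Kernel.prod_apply, Kernel.id_apply, Measure.dirac_prod,
    Measure.map_map hu (by fun_prop)]
  rfl

/-! ### Commands without sampling or loops. -/

namespace Cmd

open Classical in
/-- The effect of a command that draws no samples and contains no loop. -/
noncomputable def exec {ι : Type} [DecidableEq ι] {d : ℕ} (J : (Fin d → Bool) → ℝ) :
    Cmd ι d → (ι → ℝ) → ι → ℝ
  | skip, σ => σ
  | assign x e, σ => Function.update σ x (e.eval σ)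
  | query x z, σ => Function.update σ x (J (bits z σ))
  | seq c₁ c₂, σ => c₂.exec J (c₁.exec J σ)
  | ite a b c₁ c₂, σ => if a.eval σ ≤ b.eval σ then c₁.exec J σ else c₂.exec J σ
  | uniform _, σ => σ
  | gamma _ _, σ => σ
  | loop _ _ _, σ => σ

/-- The command draws no samples and contains no loop. -/
def IsPlain {ι : Type} {d : ℕ} : Cmd ι d → Prop
  | skip => True
  | assign _ _ => True
  | query _ _ => True
  | seq c₁ c₂ => c₁.IsPlain ∧ c₂.IsPlain
  | ite _ _ c₁ c₂ => c₁.IsPlain ∧ c₂.IsPlain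
  | uniform _ => False
  | gamma _ _ => False
  | loop _ _ _ => False

theorem IsPlain.run_eq {ι : Type} [DecidableEq ι] {d : ℕ} (J : (Fin d → Bool) → ℝ)
    {c : Cmd ι d} (hc : c.IsPlain) (σ : ι → ℝ) : c.run J σ = Measure.dirac (c.exec J σ) := by
  induction c generalizing σ with
  | skip => exact Kernel.id_apply σ
  | assign x e => rw [run, storeFun, Kernel.deterministic_apply, exec]
  | query x z => rw [run, storeFun, Kernel.deterministic_apply, exec]
  | seq c₁ c₂ ih₁ ih₂ =>
    rw [run, Kernel.comp_apply, ih₁ hc.1, Measure.dirac_bind (Kernel.measurable _), ih₂ hc.2, exec]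
  | ite a b c₁ c₂ ih₁ ih₂ =>
    rw [run, Kernel.piecewise_apply, exec, ih₁ hc.1, ih₂ hc.2]
    by_cases h : a.eval σ ≤ b.eval σ
    · rw [if_pos h]; exact if_pos h
    · rw [if_neg h]; exact if_neg h
  | uniform x => exact hc.elim
  | gamma x b => exact hc.elim
  | loop x b c _ => exact hc.elim

theorem IsPlain.measurable_exec {ι : Type} [DecidableEq ι] {d : ℕ} (J : (Fin d → Bool) → ℝ)
    {c : Cmd ι d} (hc : c.IsPlain) : Measurable (c.exec J) := by
  intro s hs
  -- Since `c.run J σ` is a point mass, it gives `s` mass one exactly when the final state lies in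
  -- `s`; measurability is inherited from the kernel.
  have h : c.exec J ⁻¹' s = (fun σ => c.run J σ s) ⁻¹' {1} := by
    ext σ
    by_cases hσ : c.exec J σ ∈ s <;> simp [hc.run_eq J, Measure.dirac_apply' _ hs, hσ]
  rw [h]
  exact (c.run J).measurable_coe hs (measurableSet_singleton 1)

/-- A plain command after a command that draws a sample. -/
theorem IsPlain.run_seq {ι Ω : Type} [DecidableEq ι] [MeasurableSpace Ω] {d : ℕ}
    (J : (Fin d → Bool) → ℝ) {c₁ c₂ : Cmd ι d} (hc : c₂.IsPlain) {σ : ι → ℝ} {μ : Measure Ω}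
    {G : Ω → ι → ℝ} (hG : Measurable G) (h : c₁.run J σ = μ.map G) :
    (seq c₁ c₂).run J σ = μ.map fun ω => c₂.exec J (G ω) := by
  have hd : c₂.run J = Kernel.deterministic (c₂.exec J) (hc.measurable_exec J) := by
    ext1 τ
    rw [hc.run_eq J, Kernel.deterministic_apply]
  rw [run, hd, Kernel.deterministic_comp_eq_map, Kernel.map_apply _ (hc.measurable_exec J), h,
    Measure.map_map (hc.measurable_exec J) hG]
  rfl

theorem run_uniform {ι : Type} [DecidableEq ι] {d : ℕ} (J : (Fin d → Bool) → ℝ) (x : ι)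
    (σ : ι → ℝ) :
    (uniform x : Cmd ι d).run J σ = unif.map (Function.update σ x) := by
  rw [run, storeKernel_apply, Kernel.const_apply]

theorem run_gamma {ι : Type} [DecidableEq ι] {d : ℕ} (J : (Fin d → Bool) → ℝ) (x b : ι)
    (σ : ι → ℝ) :
    (gamma x b : Cmd ι d).run J σ = (gammaNat ⌊σ b⌋₊).map (Function.update σ x) := by
  rw [run, storeKernel_apply]
  rfl

end Cmd

/-- A plain or sampling command that changes the view only at coordinate `i`. -/
theorem simulates_coord {d n : ℕ} {Ω : Type} [MeasurableSpace Ω] {μ : Measure Ω}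
    {κ : Kernel (Reg d → ℝ) (Reg d → ℝ)} (i : Fin d) {G : (Reg d → ℝ) → Ω → Reg d → ℝ}
    {h : ℝ × ℝ × ℝ × ℝ → (VecName → ℝ) → Ω → VecName → ℝ} (hG : ∀ σ, Measurable (G σ))
    (hκ : ∀ σ, σ (S .n) = (n : ℝ) → κ σ = μ.map (G σ))
    (hm : ∀ x, Measurable fun q : ((ℝ × ℝ × ℝ × ℝ) × (VecName → ℝ)) × Ω => h q.1.1 q.1.2 q.2 x)
    (hv : ∀ σ ω, (view (G σ ω)).2 = (view σ).2)
    (hi : ∀ σ ω, (view (G σ ω)).1 i = h (view σ).2 ((view σ).1 i) ω)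
    (hne : ∀ σ ω k, k ≠ i → (view (G σ ω)).1 k = (view σ).1 k) :
    Simulates n κ μ fun a ω => (Function.update a.1 i (h a.2 (a.1 i) ω), a.2) := by
  refine Simulates.of_map hG hκ ?_ (fun a ω ha => ha) fun σ ω => ?_
  · refine Measurable.prodMk (measurable_pi_iff.2 fun k => measurable_pi_iff.2 fun x => ?_)
      (by fun_prop)
    by_cases hk : k = i
    · subst hk
      simp only [Function.update_self]
      exact (hm x).comp (f := fun q : View d × Ω => ((q.1.2, q.1.1 k), q.2)) (by fun_prop)
    · simp only [Function.update_of_ne hk]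
      fun_prop
  · refine Prod.ext (funext fun k => ?_) (hv σ ω)
    by_cases hk : k = i
    · subst hk
      simpa using hi σ ω
    · simpa [Function.update_of_ne hk] using hne σ ω k hk

theorem simulates_coord_plain {d n : ℕ} (J : (Fin d → Bool) → ℝ) {c : Cmd (Reg d) d}
    (hc : c.IsPlain) (i : Fin d) {h : ℝ × ℝ × ℝ × ℝ → (VecName → ℝ) → VecName → ℝ}
    (hm : ∀ x, Measurable fun q : (ℝ × ℝ × ℝ × ℝ) × (VecName → ℝ) => h q.1 q.2 x)
    (hv : ∀ σ, (view (c.exec J σ)).2 = (view σ).2)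
    (hi : ∀ σ, (view (c.exec J σ)).1 i = h (view σ).2 ((view σ).1 i))
    (hne : ∀ σ k, k ≠ i → (view (c.exec J σ)).1 k = (view σ).1 k) :
    Simulates n (c.run J) (Measure.dirac ()) fun a _ =>
      (Function.update a.1 i (h a.2 (a.1 i)), a.2) :=
  simulates_coord (G := fun σ _ => c.exec J σ) (h := fun p v _ => h p v) i
    (fun _ => measurable_const) (fun σ _ => by rw [hc.run_eq J, Measure.map_const]; simp)
    (fun x => (hm x).comp measurable_fst) (fun σ _ => hv σ) (fun σ _ => hi σ)
    (fun σ _ => hne σ)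

/-- The real number stored for a bit. -/
noncomputable def bitVal (b : Bool) : ℝ := if b then 1 else 0

theorem bitVal_eq_one_iff (b : Bool) : bitVal b = 1 ↔ b = true := by
  cases b <;> simp [bitVal]

theorem measurable_armsBit : Measurable fun q : ℝ × ℝ => armsBit q.1 q.2 := by
  refine measurable_to_bool ?_
  have h : (fun q : ℝ × ℝ => armsBit q.1 q.2) ⁻¹' {true} =
      {q | 1 / 2 < q.1} ∩ {q | q.2 ≤ q.1} ∪ {q | 1 / 2 < q.1}ᶜ ∩ {q | 1 - q.2 ≤ q.1} := by
    ext q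
    by_cases hq : 1 / 2 < q.1
    · simp [armsBit, show 2⁻¹ < q.1 by simpa using hq]
    · simp [armsBit, not_lt.2 (show q.1 ≤ 2⁻¹ by simpa using hq)]
  rw [h]
  have h1 : MeasurableSet {q : ℝ × ℝ | 1 / 2 < q.1} := measurableSet_lt (by fun_prop) (by fun_prop)
  exact (h1.inter (measurableSet_le (by fun_prop) (by fun_prop))).union
    (h1.compl.inter (measurableSet_le (by fun_prop) (by fun_prop)))

/-! ### The pieces of the ARMS program as maps of views. -/

/-- Initialization of the accumulators of a coordinate. -/
noncomputable def initCoord (v : VecName → ℝ) : VecName → ℝ :=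
  Function.update (Function.update v .accS 0) .accJS 0

theorem simulates_initCmd {d : ℕ} (n : ℕ) (J : (Fin d → Bool) → ℝ) :
    Simulates n ((Cmd.forDim fun i : Fin d => Cmd.seq (.assign (V .accS i) (.const 0))
      (.assign (V .accJS i) (.const 0))).run J) (Measure.dirac ())
      fun a _ => (fun i => initCoord (a.1 i), a.2) := by
  refine simulates_forDim_const (h := fun _ v => initCoord v) J fun i =>
    simulates_coord_plain (h := fun _ v => initCoord v) J (by exact ⟨trivial, trivial⟩) i (fun x => ?_) (fun σ => ?_) (fun σ => ?_)
      fun σ k hk => ?_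
  · cases x <;> simp [initCoord, Function.update] <;> fun_prop
  · simp [view, Cmd.exec]
  · funext x
    cases x <;> simp [view, Cmd.exec, initCoord, Expr.eval, Function.update_apply]
  · funext x
    simp [view, Cmd.exec, Function.update_apply, hk]

/-- Storing the sampled total of a coordinate. -/
noncomputable def totalCoord (v : VecName → ℝ) (t : ℝ) : VecName → ℝ :=
  Function.update (Function.update v .total t) .rem t

theorem simulates_gammaCmd {d : ℕ} (n : ℕ) (J : (Fin d → Bool) → ℝ) :
    Simulates n ((Cmd.forDim fun i : Fin d => Cmd.seq (.gamma (V .total i) (S .n))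
      (.assign (V .rem i) (rv .total i))).run J) (Measure.pi fun _ => gammaNat n)
      fun a ω => (fun i => totalCoord (a.1 i) (ω i), a.2) := by
  refine simulates_forDim (h := fun _ v t => totalCoord v t) J fun i =>
    simulates_coord (h := fun _ v t => totalCoord v t) (G := fun σ t => (Cmd.assign (V .rem i) (rv .total i)).exec J
      (Function.update σ (V .total i) t)) i (fun σ => ?_) (fun σ hσ => ?_)
      (fun x => ?_) (fun σ t => ?_) (fun σ t => ?_) fun σ t k hk => ?_
  · exact (Cmd.IsPlain.measurable_exec J (by exact trivial)).comp (measurable_update σ)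
  · refine Cmd.IsPlain.run_seq J (by exact trivial) (measurable_update σ) ?_
    rw [Cmd.run_gamma, hσ, Nat.floor_natCast]
  · cases x <;> simp [totalCoord, Function.update] <;> fun_prop
  · simp [view, Cmd.exec]
  · funext x
    cases x <;> simp [view, Cmd.exec, totalCoord, Expr.eval, Function.update_apply]
  · funext x
    simp [view, Cmd.exec, Function.update_apply, hk]

/-- The correlation, computed in real arithmetic. -/
noncomputable def rhoReal (m t : ℝ) : ℝ :=
  if t ≤ 1 / 2 then
    (max 0 (2 * t ^ (1 / (m - 1)) - 1) ^ (m - 1) - t * t) / (t * (1 - t))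
  else
    (max 0 (2 * (1 - t) ^ (1 / (m - 1)) - 1) ^ (m - 1) - (1 - t) * (1 - t)) / (t * (1 - t))

/-- The machine has only real powers and tests `≤`; the estimator uses natural powers and tests `>`.
-/
theorem rhoReal_eq_armsRho (n : ℕ) (hn : 1 ≤ n) (t : ℝ) : rhoReal n t = armsRho n t := by
  have h : (n : ℝ) - 1 = ((n - 1 : ℕ) : ℝ) := by rw [Nat.cast_sub hn, Nat.cast_one]
  have hp : ∀ x : ℝ, x ^ ((n : ℝ) - 1) = x ^ (n - 1) := fun x => by rw [h, Real.rpow_natCast]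
  simp only [rhoReal, armsRho, hp, sq]
  by_cases ht : t ≤ 1 / 2
  · rw [if_pos ht, if_neg (not_lt.2 ht)]
  · rw [if_neg ht, if_pos (not_le.1 ht)]

theorem measurable_rhoReal : Measurable fun q : ℝ × ℝ => rhoReal q.1 q.2 := by
  unfold rhoReal
  exact Measurable.ite (measurableSet_le (by fun_prop) (by fun_prop)) (by fun_prop) (by fun_prop)

/-- Storing the correlation of a coordinate. -/
noncomputable def rhoCoord (p : ℝ × ℝ × ℝ × ℝ) (v : VecName → ℝ) : VecName → ℝ :=
  Function.update v .rho (rhoReal p.1 (v .theta))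

theorem exec_rhoCmd {d : ℕ} (J : (Fin d → Bool) → ℝ) (i : Fin d) (σ : Reg d → ℝ) :
    (rhoCmd i).exec J σ = Function.update σ (V .rho i) (rhoReal (σ (S .n)) (σ (V .theta i))) := by
  simp only [rhoCmd, Cmd.exec, Expr.eval, rhoExpr, rhoReal, Nat.cast_ofNat, Nat.cast_one,
    Nat.cast_zero]
  split_ifs <;> rfl

theorem simulates_rhoCmd {d : ℕ} (n : ℕ) (J : (Fin d → Bool) → ℝ) :
    Simulates n ((Cmd.forDim (rhoCmd (d := d))).run J) (Measure.dirac ())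
      fun a _ => (fun i => rhoCoord a.2 (a.1 i), a.2) := by
  refine simulates_forDim_const (h := rhoCoord) J fun i =>
    simulates_coord_plain J (by exact ⟨trivial, trivial⟩) i (fun x => ?_) (fun σ => ?_)
      (fun σ => ?_) fun σ k hk => ?_
  · have := measurable_rhoReal.comp (f := fun q : (ℝ × ℝ × ℝ × ℝ) × (VecName → ℝ) =>
      (q.1.1, q.2 .theta)) (by fun_prop)
    cases x <;> simp [rhoCoord, Function.update] <;> first | exact this | fun_prop
  · simp [view, exec_rhoCmd]
  · funext x
    cases x <;> simp [view, exec_rhoCmd, rhoCoord, Function.update_apply]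
  · funext x
    simp [view, exec_rhoCmd, Function.update_apply, hk]

/-- The summand drawn for a coordinate in a round. -/
noncomputable def drawCoord (p : ℝ × ℝ × ℝ × ℝ) (v : VecName → ℝ) (u : ℝ) : ℝ :=
  if p.1 ≤ p.2.1 then v .rem else v .rem - v .rem * u ^ (1 / (p.1 - p.2.1))

/-- The copula uniform obtained for a coordinate in a round. -/
noncomputable def uniformCoord (p : ℝ × ℝ × ℝ × ℝ) (v : VecName → ℝ) (u : ℝ) : ℝ :=
  1 - (1 - drawCoord p v u / v .total) ^ (p.1 - 1)

/-- Sampling the bit of a coordinate. -/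
noncomputable def sampleCoord (p : ℝ × ℝ × ℝ × ℝ) (v : VecName → ℝ) (u : ℝ) : VecName → ℝ :=
  Function.update (Function.update v .rem (v .rem - drawCoord p v u)) .z
    (bitVal (armsBit (v .theta) (uniformCoord p v u)))

/-- The part of `sampleCmd` after the draw. -/
def sampleRest {d : ℕ} (i : Fin d) : Cmd (Reg d) d := .block [
  .assign (V .rem i) (.sub (rv .rem i) (rs .e)),
  .assign (S .dir) (.div (rs .e) (rv .total i)),
  .assign (S .w)
    (.sub (.const 1) (.pow (.sub (.const 1) (rs .dir)) (.sub (rs .n) (.const 1)))),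
  .ite (rv .theta i) (.div (.const 1) (.const 2))
    (.ite (.sub (.const 1) (rs .w)) (rv .theta i)
      (.assign (V .z i) (.const 1)) (.assign (V .z i) (.const 0)))
    (.ite (rs .w) (rv .theta i)
      (.assign (V .z i) (.const 1)) (.assign (V .z i) (.const 0)))]

theorem exec_sampleRest {d : ℕ} (J : (Fin d → Bool) → ℝ) (i : Fin d) (σ : Reg d → ℝ) :
    (sampleRest i).exec J σ =
      Function.update (Function.update (Function.update (Function.update σ
        (V .rem i) (σ (V .rem i) - σ (S .e))) (S .dir) (σ (S .e) / σ (V .total i)))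
          (S .w) (1 - (1 - σ (S .e) / σ (V .total i)) ^ (σ (S .n) - 1))) (V .z i)
            (bitVal (armsBit (σ (V .theta i))
              (1 - (1 - σ (S .e) / σ (V .total i)) ^ (σ (S .n) - 1)))) := by
  set w := 1 - (1 - σ (S .e) / σ (V .total i)) ^ (σ (S .n) - 1) with hw
  simp only [sampleRest, Cmd.block, Cmd.exec, Expr.eval]
  simp only [Function.update_apply, reduceCtorEq, Sum.inl.injEq, Sum.inr.injEq, Prod.mk.injEq,
    if_false, if_true, false_and, Nat.cast_one, Nat.cast_ofNat, Nat.cast_zero, ← hw]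
  by_cases h : σ (V .theta i) ≤ 1 / 2
  · by_cases h' : 1 - w ≤ σ (V .theta i)
    · simp only [if_pos h, armsBit, gt_iff_lt, not_lt.2 h, if_false, h', decide_true,
        bitVal, if_true]
    · simp only [if_pos h, armsBit, gt_iff_lt, not_lt.2 h, if_false, h', decide_false,
        bitVal, Bool.false_eq_true]
  · by_cases h' : w ≤ σ (V .theta i)
    · simp only [if_neg h, armsBit, gt_iff_lt, not_le.1 h, if_true, h', decide_true,
        bitVal]
    · simp only [if_neg h, armsBit, gt_iff_lt, not_le.1 h, if_true, h', decide_false,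
        bitVal, if_false, Bool.false_eq_true]

/-- The effect of the draw in `sampleCmd`, with the uniform sample as an argument. -/
noncomputable def drawState {d : ℕ} (i : Fin d) (σ : Reg d → ℝ) (u : ℝ) : Reg d → ℝ :=
  if σ (S .n) ≤ σ (S .s) then Function.update σ (S .e) (σ (V .rem i))
  else Function.update (Function.update σ (S .u) u) (S .e)
    (σ (V .rem i) - σ (V .rem i) * u ^ (1 / (σ (S .n) - σ (S .s))))

theorem measurable_drawState {d : ℕ} (i : Fin d) (σ : Reg d → ℝ) : Measurable (drawState i σ) := by
  unfold drawState
  split_ifs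
  · exact measurable_const
  · refine measurable_pi_iff.2 fun x => ?_
    simp only [Function.update_apply]
    split_ifs <;> fun_prop

/-- In the last round nothing is sampled and `drawState` ignores its argument, so a dummy uniform
leaves the law unchanged. All rounds then have the same source. -/
theorem run_sampleCmd {d : ℕ} (J : (Fin d → Bool) → ℝ) (i : Fin d) (σ : Reg d → ℝ) :
    (sampleCmd i).run J σ = unif.map fun u => (sampleRest i).exec J (drawState i σ u) := by
  refine Cmd.IsPlain.run_seq J (c₂ := sampleRest i) ?_ (measurable_drawState i σ) ?_
  · simp [sampleRest, Cmd.block, Cmd.IsPlain]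
  · rw [Cmd.run, Kernel.piecewise_apply]
    by_cases h : σ (S .n) ≤ σ (S .s)
    · refine (if_pos h).trans ?_
      rw [Cmd.IsPlain.run_eq J (by exact trivial)]
      have hd : drawState i σ = fun _ => Function.update σ (S .e) (σ (V .rem i)) := by
        funext u
        simp only [drawState, if_pos h]
      simp [hd, Measure.map_const, Cmd.exec, Expr.eval]
    · refine (if_neg h).trans ?_
      rw [Cmd.IsPlain.run_seq J (by exact trivial) (measurable_update σ) (Cmd.run_uniform J (S .u) σ)]
      congr 1
      funext u
      simp only [drawState, if_neg h, Cmd.exec, Expr.eval]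
      simp

theorem measurable_drawCoord :
    Measurable fun q : ((ℝ × ℝ × ℝ × ℝ) × (VecName → ℝ)) × ℝ => drawCoord q.1.1 q.1.2 q.2 :=
  Measurable.ite (measurableSet_le (by fun_prop) (by fun_prop)) (by fun_prop) (by fun_prop)

theorem measurable_bitVal : Measurable bitVal := measurable_of_finite _

theorem simulates_sampleCmd {d : ℕ} (n : ℕ) (J : (Fin d → Bool) → ℝ) :
    Simulates n ((Cmd.forDim (sampleCmd (d := d))).run J) (Measure.pi fun _ => unif)
      fun a u => (fun i => sampleCoord a.2 (a.1 i) (u i), a.2) := by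
  refine simulates_forDim (h := sampleCoord) J fun i =>
    simulates_coord (h := sampleCoord) (G := fun σ u => (sampleRest i).exec J (drawState i σ u)) i
      (fun σ => ?_) (fun σ _ => run_sampleCmd J i σ)
      (fun x => ?_) (fun σ t => ?_) (fun σ t => ?_) fun σ t k hk => ?_
  · exact (Cmd.IsPlain.measurable_exec J (by simp [sampleRest, Cmd.block, Cmd.IsPlain])).comp
      (measurable_drawState i σ)
  · have h1 := measurable_drawCoord
    have h2 := measurable_bitVal.comp (measurable_armsBit.comp
      (f := fun q : ((ℝ × ℝ × ℝ × ℝ) × (VecName → ℝ)) × ℝ =>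
        (q.1.2 .theta, uniformCoord q.1.1 q.1.2 q.2)) (by unfold uniformCoord; fun_prop))
    cases x <;> simp [sampleCoord, Function.update] <;> first | exact h2 | fun_prop
  · simp only [exec_sampleRest, view, drawState]
    split_ifs <;> simp
  · funext x
    simp only [exec_sampleRest, view, drawState, sampleCoord, uniformCoord, drawCoord]
    by_cases h : σ (S .n) ≤ σ (S .s) <;> cases x <;> simp [h]
  · funext x
    simp only [exec_sampleRest, view, drawState]
    split_ifs <;> simp [hk]

/-- The accumulator update `max(s-2,1)/max(s-1,1) * a + 1/max(s-1,1) * b`. -/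
noncomputable def accReal (s a b : ℝ) : ℝ :=
  max (s - 2) 1 / max (s - 1) 1 * a + 1 / max (s - 1) 1 * b

/-- The partial derivative of `log p_θ` in terms of the parameter and the bit. -/
noncomputable def scoreReal (t z : ℝ) : ℝ := z / t - (1 - z) / (1 - t)

/-- Updating the accumulators of a coordinate. -/
noncomputable def accCoord (p : ℝ × ℝ × ℝ × ℝ) (v : VecName → ℝ) : VecName → ℝ :=
  Function.update (Function.update v .accS
    (accReal p.2.1 (v .accS) (scoreReal (v .theta) (v .z)))) .accJS
    (accReal p.2.1 (v .accJS) (p.2.2.1 * scoreReal (v .theta) (v .z)))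

theorem simulates_accCmd {d : ℕ} (n : ℕ) (J : (Fin d → Bool) → ℝ) :
    Simulates n ((Cmd.forDim fun i : Fin d => Cmd.seq
      (.assign (V .accS i) (accExpr (rv .accS i) (scoreExpr i)))
      (.assign (V .accJS i) (accExpr (rv .accJS i) (.mul (rs .j) (scoreExpr i))))).run J)
      (Measure.dirac ()) fun a _ => (fun i => accCoord a.2 (a.1 i), a.2) := by
  refine simulates_forDim_const (h := accCoord) J fun i =>
    simulates_coord_plain J (by exact ⟨trivial, trivial⟩) i (fun x => ?_) (fun σ => ?_)
      (fun σ => ?_) fun σ k hk => ?_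
  · cases x <;> simp [accCoord, accReal, scoreReal, Function.update] <;> fun_prop
  · simp [view, Cmd.exec]
  · funext x
    cases x <;> simp [view, Cmd.exec, accCoord, accReal, scoreReal, accExpr, scoreExpr, Expr.eval,
      Function.update_apply]
  · funext x
    simp [view, Cmd.exec, Function.update_apply, hk]

/-- Storing the output of a coordinate. -/
noncomputable def outCoord (p : ℝ × ℝ × ℝ × ℝ) (v : VecName → ℝ) : VecName → ℝ :=
  Function.update v .g (1 / (1 - v .rho) * (v .accJS - v .accS * p.2.2.2))

theorem simulates_outCmd {d : ℕ} (n : ℕ) (J : (Fin d → Bool) → ℝ) :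
    Simulates n ((Cmd.forDim fun i : Fin d => Cmd.assign (V .g i)
    (.mul (.div (.const 1) (.sub (.const 1) (rv .rho i)))
      (.sub (rv .accJS i) (.mul (rv .accS i) (rs .meanJ))))).run J)
      (Measure.dirac ()) fun a _ => (fun i => outCoord a.2 (a.1 i), a.2) := by
  refine simulates_forDim_const (h := outCoord) J fun i =>
    simulates_coord_plain J (by exact trivial) i (fun x => ?_) (fun σ => ?_)
      (fun σ => ?_) fun σ k hk => ?_
  · cases x <;> simp [outCoord, Function.update] <;> fun_prop
  · simp [view, Cmd.exec]
  · funext x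
    cases x <;> simp [view, Cmd.exec, outCoord, Expr.eval, Function.update_apply]
  · funext x
    simp [view, Cmd.exec, Function.update_apply, hk]

/-- The bits of the current sample. -/
noncomputable def viewBits {d : ℕ} (a : View d) : Fin d → Bool :=
  bits (ι := Fin d × VecName) (fun i => (i, .z)) fun q => a.1 q.1 q.2

theorem measurable_viewBits {d : ℕ} : Measurable (viewBits (d := d)) :=
  (measurable_bits _).comp (by fun_prop)

/-- Querying the oracle. -/
noncomputable def queryView {d : ℕ} (J : (Fin d → Bool) → ℝ) (a : View d) : View d :=
  (a.1, a.2.1, a.2.2.1, J (viewBits a), a.2.2.2.2)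

theorem simulates_queryCmd {d : ℕ} (n : ℕ) (J : (Fin d → Bool) → ℝ) :
    Simulates n ((Cmd.query (S .j) (V .z)).run J) (Measure.dirac ())
      fun a _ => queryView J a := by
  refine Simulates.of_dirac (g := (Cmd.query (S .j) (V .z)).exec J)
    (fun σ => Cmd.IsPlain.run_eq J (by exact trivial) σ) ?_ (fun a ha => ha) fun σ => ?_
  · have := (measurable_of_finite J).comp (measurable_viewBits (d := d))
    unfold queryView
    exact measurable_fst.prodMk (measurable_snd.fst.prodMk (measurable_snd.snd.fst.prodMk
      (this.prodMk measurable_snd.snd.snd.snd)))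
  · simp [view, Cmd.exec, queryView, viewBits]
    rfl

/-- Updating the running mean. -/
noncomputable def meanView {d : ℕ} (a : View d) : View d :=
  (a.1, a.2.1, a.2.2.1, a.2.2.2.1,
    (a.2.2.1 - 1) / a.2.2.1 * a.2.2.2.2 + 1 / a.2.2.1 * a.2.2.2.1)

theorem simulates_meanCmd {d : ℕ} (n : ℕ) (J : (Fin d → Bool) → ℝ) :
    Simulates n ((Cmd.assign (S .meanJ) (.add
    (.mul (.div (.sub (rs .s) (.const 1)) (rs .s)) (rs .meanJ))
    (.mul (.div (.const 1) (rs .s)) (rs .j)))).run J) (Measure.dirac ())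
      fun a _ => meanView (d := d) a := by
  refine Simulates.of_dirac (g := Cmd.exec J _)
    (fun σ => Cmd.IsPlain.run_eq J (by exact trivial) σ) (by unfold meanView; fun_prop) (fun a ha => ha)
    fun σ => ?_
  simp [view, Cmd.exec, meanView, Expr.eval]

theorem simulates_zeroCmd {d : ℕ} (n : ℕ) (J : (Fin d → Bool) → ℝ) :
    Simulates n ((Cmd.assign (S .meanJ) (.const 0)).run J) (Measure.dirac ())
      fun a _ => ((a.1, a.2.1, a.2.2.1, a.2.2.2.1, 0) : View d) := by
  refine Simulates.of_dirac (g := Cmd.exec J _)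
    (f := fun a => ((a.1, a.2.1, a.2.2.1, a.2.2.2.1, 0) : View d))
    (fun σ => Cmd.IsPlain.run_eq J (by exact trivial) σ) (by fun_prop) (fun a ha => ha) fun σ => ?_
  simp [view, Cmd.exec, Expr.eval]

/-- One round of the main loop, on views. -/
noncomputable def roundView {d : ℕ} (J : (Fin d → Bool) → ℝ) (a : View d) (u : Fin d → ℝ) :
    View d :=
  let b := meanView (queryView J (fun i => sampleCoord a.2 (a.1 i) (u i), a.2))
  (fun i => accCoord b.2 (b.1 i), b.2)

theorem simulates_roundCmd {d : ℕ} (n : ℕ) (J : (Fin d → Bool) → ℝ) :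
    Simulates n ((roundCmd d).run J) (Measure.pi fun _ => unif) (roundView J) :=
  (simulates_sampleCmd n J).comp_const ((simulates_queryCmd n J).const_comp
    ((simulates_meanCmd n J).const_comp ((simulates_accCmd n J).const_comp Simulates.id)))

/-- The state of the program before the main loop, on views. -/
noncomputable def startView {d : ℕ} (a : View d) (t : Fin d → ℝ) : View d :=
  (fun i => rhoCoord (a.2.1, a.2.2.1, a.2.2.2.1, 0) (totalCoord (initCoord (a.1 i)) (t i)),
    a.2.1, a.2.2.1, a.2.2.2.1, 0)

theorem simulates_iterARMS {d : ℕ} (n : ℕ) (J : (Fin d → Bool) → ℝ) :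
    Simulates n ((iterARMS d).run J)
      ((Measure.pi fun _ : Fin d => gammaNat n).prod
        (Measure.pi fun _ : Fin n => Measure.pi fun _ : Fin d => unif))
      fun a ω =>
        let b := loopView (roundView J) n (startView a ω.1) ω.2
        (fun i => outCoord b.2 (b.1 i), b.2) :=
  (simulates_zeroCmd n J).const_comp ((simulates_initCmd n J).const_comp
    ((simulates_gammaCmd n J).comp ((simulates_rhoCmd n J).const_comp
      ((simulates_loop J (simulates_roundCmd n J)).comp_const
        ((simulates_outCmd n J).const_comp Simulates.id)))))

/-! ### Sorting the randomness by coordinates. -/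

/-- Fubini's theorem for finite products: exchanging the two indices of a family of i.i.d.
variables. -/
theorem pi_pi_map_swap {ι κ α : Type} [Fintype ι] [Fintype κ] [MeasurableSpace α] (μ : Measure α)
    [IsProbabilityMeasure μ] :
    (Measure.pi fun _ : ι => Measure.pi fun _ : κ => μ).map (fun U k i => U i k) =
      Measure.pi fun _ : κ => Measure.pi fun _ : ι => μ := by
  -- Both iterated products are curried forms of one product over pairs, where the exchange is a
  -- reindexing.
  have hcurry : ∀ (ι κ : Type) [Fintype ι] [Fintype κ],
      (Measure.pi fun _ : ι × κ => μ).map (MeasurableEquiv.curry ι κ α) =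
        Measure.pi fun _ : ι => Measure.pi fun _ : κ => μ := by
    intro ι κ _ _
    have h := Measure.infinitePi_map_curry (fun (_ : ι) (_ : κ) => μ)
    simpa only [Measure.infinitePi_eq_pi] using h
  have hcomm := Measure.pi_map_piCongrLeft (Equiv.prodComm ι κ) (β := fun _ => α) fun _ => μ
  rw [← hcurry ι κ, ← hcurry κ ι, ← hcomm, Measure.map_map (by fun_prop) (by fun_prop),
    Measure.map_map (by fun_prop) (by fun_prop)]
  congr 1

/-- The randomness of the program, sorted by coordinates; the uniforms of the last round are
dropped. -/
def sortSource {d n : ℕ} (ω : (Fin d → ℝ) × (Fin n → Fin d → ℝ)) (i : Fin d) :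
    ℝ × (Fin (n - 1) → ℝ) :=
  (ω.1 i, fun k => ω.2 (Fin.castLE (Nat.sub_le n 1) k) i)

theorem map_sortSource (d n : ℕ) (hn : 1 ≤ n) :
    ((Measure.pi fun _ : Fin d => gammaNat n).prod
        (Measure.pi fun _ : Fin n => Measure.pi fun _ : Fin d => unif)).map sortSource =
      Measure.pi fun _ => iterSource n := by
  obtain ⟨m, rfl⟩ : ∃ m, n = m + 1 := ⟨n - 1, by omega⟩
  have hg : gammaNat (m + 1) = gammaMeasure ((m + 1 : ℕ) : ℝ) 1 := if_neg (by simp)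
  set ν : Measure (Fin d → ℝ) := Measure.pi fun _ => unif
  -- Dropping the dummy uniforms of the last round is a marginalization.
  have hinit : (Measure.pi fun _ : Fin (m + 1) => ν).map
      (fun U (k : Fin m) => U k.castSucc) = Measure.pi fun _ => ν := by
    rw [pi_fin_succ_last, Measure.map_map (by fun_prop) (measurable_fin_snoc m)]
    have h : ((fun (U : Fin (m + 1) → Fin d → ℝ) (k : Fin m) => U k.castSucc) ∘
        fun p : (Fin m → Fin d → ℝ) × (Fin d → ℝ) =>
          (Fin.snoc p.1 p.2 : Fin (m + 1) → Fin d → ℝ)) = Prod.fst := by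
      funext p k
      simp
    rw [h, Measure.map_fst_prod]
    simp
  have hmid : (Measure.pi fun _ : Fin (m + 1) => ν).map
      (fun U i (k : Fin m) => U k.castSucc i) = Measure.pi fun _ => iidUnif m := by
    rw [show (Measure.pi fun _ : Fin d => iidUnif m) = _ from (pi_pi_map_swap unif).symm, ← hinit,
      Measure.map_map (by fun_prop) (by fun_prop)]
    rfl
  have hzip := (measurePreserving_arrowProdEquivProdArrow ℝ (Fin m → ℝ) (Fin d)
    (fun _ => gammaNat (m + 1)) (fun _ => iidUnif m)).symm.map_eq
  change _ = Measure.pi fun _ => (gammaMeasure ((m + 1 : ℕ) : ℝ) 1).prod (iidUnif m)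
  rw [← hg, ← hzip, ← hmid]
  nth_rewrite 2 [← Measure.map_id (μ := Measure.pi fun _ : Fin d => gammaNat (m + 1))]
  rw [Measure.map_prod_map _ _ measurable_id (by fun_prop),
    Measure.map_map (MeasurableEquiv.measurable _) (by fun_prop)]
  rfl

/-! ### Algebra of the estimator. -/

theorem score_eq_scoreReal {d : ℕ} {θ : Fin d → ℝ} (hθ : ∀ i, θ i ∈ Set.Ioo (0 : ℝ) 1)
    (z : Fin d → Bool) (i : Fin d) : score θ z i = scoreReal (θ i) (bitVal (z i)) := by
  -- The factors of the other coordinates form a nonzero constant, which cancels in the logarithmic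
  -- derivative.
  set c := ∏ k ∈ Finset.univ.erase i, if z k then θ k else 1 - θ k with hc
  have hc0 : c ≠ 0 := by
    refine Finset.prod_ne_zero_iff.2 fun k _ => ?_
    have h1 := (hθ k).1
    have h2 := (hθ k).2
    split_ifs <;> linarith
  have hprob : ∀ t, bernProb (Function.update θ i t) z = (if z i then t else 1 - t) * c := by
    intro t
    rw [bernProb, ← Finset.mul_prod_erase _ _ (Finset.mem_univ i), hc, Function.update_self]
    congr 1
    refine Finset.prod_congr rfl fun k hk => ?_
    rw [Function.update_of_ne (Finset.ne_of_mem_erase hk)]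
  have h1 := (hθ i).1
  have h2 := (hθ i).2
  simp only [score, hprob]
  cases hz : z i
  · have hd : HasDerivAt (fun t => Real.log ((1 - t) * c)) ((-1 * c) / ((1 - θ i) * c)) (θ i) :=
      (((hasDerivAt_id' (θ i)).const_sub 1).mul_const c).log (mul_ne_zero (by linarith) hc0)
    simp only [Bool.false_eq_true, if_false]
    rw [hd.deriv]
    simp only [scoreReal, bitVal, Bool.false_eq_true, if_false]
    rw [mul_div_mul_right _ _ hc0]
    ring
  · have hd : HasDerivAt (fun t => Real.log (t * c)) ((1 * c) / (θ i * c)) (θ i) :=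
      ((hasDerivAt_id' (θ i)).mul_const c).log (mul_ne_zero (by linarith) hc0)
    simp only [if_true]
    rw [hd.deriv]
    simp only [scoreReal, bitVal, if_true]
    rw [mul_div_mul_right _ _ hc0]
    ring

/-- The leave-one-out estimator in terms of sums over all samples. -/
theorem loorf_eq {d n : ℕ} (hn : 2 ≤ n) (J : (Fin d → Bool) → ℝ) (θ : Fin d → ℝ)
    (z : Fin n → Fin d → Bool) (i : Fin d) :
    loorf J θ z i =
      1 / ((n : ℝ) - 1) * ∑ s, J (z s) * score θ (z s) i -
        1 / ((n : ℝ) - 1) * (∑ s, score θ (z s) i) * (1 / (n : ℝ) * ∑ s, J (z s)) := by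
  have hn0 : (n : ℝ) ≠ 0 := by positivity
  have hn1 : (n : ℝ) - 1 ≠ 0 := by
    have : (2 : ℝ) ≤ n := by exact_mod_cast hn
    linarith
  have herase : ∀ s, ∑ t ∈ Finset.univ.erase s, J (z t) = (∑ t, J (z t)) - J (z s) := by
    intro s
    rw [← Finset.add_sum_erase _ _ (Finset.mem_univ s)]
    ring
  simp only [loorf, herase]
  set A := ∑ t, J (z t)
  have hterm : ∀ s, (J (z s) - 1 / ((n : ℝ) - 1) * (A - J (z s))) * score θ (z s) i =
      (n / ((n : ℝ) - 1)) * (J (z s) * score θ (z s) i) -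
        (A / ((n : ℝ) - 1)) * score θ (z s) i := by
    intro s
    field_simp
    ring
  simp only [hterm, Finset.sum_sub_distrib, ← Finset.mul_sum]
  field_simp

/-- The ARMS estimator as a function of the copula uniforms. -/
noncomputable def estimator {d n : ℕ} (J : (Fin d → Bool) → ℝ) (θ : Fin d → ℝ)
    (w : Fin d → Fin n → ℝ) (i : Fin d) : ℝ :=
  1 / (1 - armsRho n (θ i)) * loorf J θ (fun s j => armsBit (θ j) (w j s)) i

theorem measurable_estimator {d n : ℕ} (J : (Fin d → Bool) → ℝ) (θ : Fin d → ℝ) :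
    Measurable (estimator (n := n) J θ) := by
  have hbit : Measurable fun (w : Fin d → Fin n → ℝ) (s : Fin n) (j : Fin d) =>
      armsBit (θ j) (w j s) :=
    measurable_pi_iff.2 fun s => measurable_pi_iff.2 fun j =>
      measurable_armsBit.comp (measurable_const.prodMk (by fun_prop))
  refine measurable_pi_iff.2 fun i => Measurable.const_mul ?_ _
  exact (measurable_of_finite fun z : Fin n → Fin d → Bool => loorf J θ z i).comp hbit

/-! ### The loop invariant and equality of the output laws. -/

/-- The bits of the sample of round `k + 1`, from the randomness of the iterative procedures. -/
noncomputable def roundBits {d : ℕ} (n : ℕ) (θ : Fin d → ℝ)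
    (p : Fin d → ℝ × (Fin (n - 1) → ℝ)) (k : ℕ) (i : Fin d) : Bool :=
  armsBit (θ i)
    (1 - (1 - iterDraw n (p i).2 k (iterRem n (p i).1 (p i).2 k) / (p i).1) ^ (n - 1))

/-- The views that occur after `m` rounds of the main loop. -/
structure LoopInvariant {d : ℕ} (n : ℕ) (J : (Fin d → Bool) → ℝ) (θ : Fin d → ℝ)
    (p : Fin d → ℝ × (Fin (n - 1) → ℝ)) (m : ℕ) (a : View d) : Prop where
  n_eq : a.2.1 = n
  mean_eq : a.2.2.2.2 = 1 / (m : ℝ) * ∑ k ∈ Finset.range m, J (roundBits n θ p k)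
  theta_eq : ∀ i, a.1 i .theta = θ i
  total_eq : ∀ i, a.1 i .total = (p i).1
  rem_eq : ∀ i, a.1 i .rem = iterRem n (p i).1 (p i).2 m
  rho_eq : ∀ i, a.1 i .rho = rhoReal n (θ i)
  accS_eq : ∀ i, a.1 i .accS = 1 / max ((m : ℝ) - 1) 1 *
    ∑ k ∈ Finset.range m, scoreReal (θ i) (bitVal (roundBits n θ p k i))
  accJS_eq : ∀ i, a.1 i .accJS = 1 / max ((m : ℝ) - 1) 1 *
    ∑ k ∈ Finset.range m, J (roundBits n θ p k) * scoreReal (θ i) (bitVal (roundBits n θ p k i))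

/-- The numerator `max(s-2,1)` at `s = m + 1` cancels the previous normalization `max(m-1,1)`, so an
accumulator is always a plain sum divided by `max(m-1,1)`. -/
theorem accReal_succ (m : ℕ) (x y : ℝ) :
    accReal ((m + 1 : ℕ) : ℝ) (1 / max ((m : ℝ) - 1) 1 * x) y =
      1 / max (((m + 1 : ℕ) : ℝ) - 1) 1 * (x + y) := by
  have h1 : ((m + 1 : ℕ) : ℝ) - 2 = m - 1 := by push_cast; ring
  have h2 : 0 < max ((m : ℝ) - 1) 1 := lt_max_of_lt_right one_pos
  rw [accReal, h1]
  have h3 : 0 < max (((m + 1 : ℕ) : ℝ) - 1) 1 := lt_max_of_lt_right one_pos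
  field_simp

theorem loopInvariant_start {d : ℕ} (n : ℕ) (J : (Fin d → Bool) → ℝ) (θ : Fin d → ℝ)
    (ω : (Fin d → ℝ) × (Fin n → Fin d → ℝ)) :
    LoopInvariant n J θ (sortSource ω) 0 (startView (view (initState n θ)) ω.1) := by
  constructor <;>
    simp [startView, view, initState, rhoCoord, totalCoord, initCoord, sortSource, iterRem]

theorem loopInvariant_succ {d n : ℕ} (J : (Fin d → Bool) → ℝ) (θ : Fin d → ℝ)
    (ω : (Fin d → ℝ) × (Fin n → Fin d → ℝ)) {m : ℕ} (hm : m < n) {a : View d}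
    (h : LoopInvariant n J θ (sortSource ω) m a) :
    LoopInvariant n J θ (sortSource ω) (m + 1)
      (roundView J (setCounter a ((m + 1 : ℕ) : ℝ)) (ω.2 ⟨m, hm⟩)) := by
  set p := sortSource ω with hp
  have hnat : (n : ℝ) - 1 = ((n - 1 : ℕ) : ℝ) := by
    rw [Nat.cast_sub (by omega), Nat.cast_one]
  have hdraw : ∀ i, drawCoord (setCounter a ((m + 1 : ℕ) : ℝ)).2 (a.1 i) (ω.2 ⟨m, hm⟩ i) =
      iterDraw n (p i).2 m (iterRem n (p i).1 (p i).2 m) := by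
    intro i
    simp only [drawCoord, setCounter, h.n_eq, h.rem_eq, iterDraw]
    -- Round `m + 1` is the last one exactly when the machine test `n ≤ s` succeeds with `s = m +
    -- 1`.
    by_cases hlt : m < n - 1
    · rw [if_neg (by rw [Nat.cast_le]; omega), dif_pos hlt]
      rfl
    · rw [if_pos (by rw [Nat.cast_le]; omega), dif_neg hlt]
  have hbit : ∀ i, armsBit (a.1 i .theta)
      (uniformCoord (setCounter a ((m + 1 : ℕ) : ℝ)).2 (a.1 i) (ω.2 ⟨m, hm⟩ i)) =
        roundBits n θ p m i := by
    intro i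
    rw [uniformCoord, hdraw, h.theta_eq, h.total_eq]
    simp only [setCounter, h.n_eq]
    rw [hnat, Real.rpow_natCast, roundBits]
  have hz : ∀ i, sampleCoord (setCounter a ((m + 1 : ℕ) : ℝ)).2 (a.1 i) (ω.2 ⟨m, hm⟩ i) =
      Function.update (Function.update (a.1 i) .rem (iterRem n (p i).1 (p i).2 (m + 1))) .z
        (bitVal (roundBits n θ p m i)) := by
    intro i
    rw [sampleCoord, hbit, hdraw, h.rem_eq, iterRem]
  have hround : roundView J (setCounter a ((m + 1 : ℕ) : ℝ)) (ω.2 ⟨m, hm⟩) =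
      (let b := meanView (queryView J (fun i => Function.update (Function.update (a.1 i) .rem
        (iterRem n (p i).1 (p i).2 (m + 1))) .z (bitVal (roundBits n θ p m i)),
          (setCounter a ((m + 1 : ℕ) : ℝ)).2))
      (fun i => accCoord b.2 (b.1 i), b.2)) := by
    rw [← funext hz]
    rfl
  have hbits : ∀ q, viewBits (d := d) (fun i => Function.update (Function.update (a.1 i) .rem
        (iterRem n (p i).1 (p i).2 (m + 1))) .z (bitVal (roundBits n θ p m i)), q) =
      roundBits n θ p m := by
    intro q
    funext i
    simp [viewBits, bits, bitVal_eq_one_iff]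
  rw [hround]
  simp only [queryView, hbits, meanView, setCounter]
  constructor
  · exact h.n_eq
  · simp only [h.mean_eq, Finset.sum_range_succ]
    -- For `m = 0` the old mean is the empty sum times `1 / 0 = 0`, and its weight `(s - 1) / s`
    -- vanishes as well.
    rcases Nat.eq_zero_or_pos m with rfl | hpos
    · simp
    · have : (m : ℝ) ≠ 0 := by positivity
      push_cast
      field_simp
      ring
  · intro i; simpa [accCoord] using h.theta_eq i
  · intro i; simpa [accCoord] using h.total_eq i
  · intro i; simp [accCoord]
  · intro i; simpa [accCoord] using h.rho_eq i
  · intro i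
    rw [Finset.sum_range_succ, ← accReal_succ]
    simp [accCoord, h.accS_eq, h.theta_eq]
  · intro i
    rw [Finset.sum_range_succ, ← accReal_succ]
    simp [accCoord, h.accJS_eq, h.theta_eq]

theorem loopInvariant_loopView {d n : ℕ} (J : (Fin d → Bool) → ℝ) (θ : Fin d → ℝ)
    (ω : (Fin d → ℝ) × (Fin n → Fin d → ℝ)) (m : ℕ) (hm : m ≤ n) :
    LoopInvariant n J θ (sortSource ω) m
      (loopView (roundView J) m (startView (view (initState n θ)) ω.1)
        fun k => ω.2 (Fin.castLE hm k)) := by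
  induction m with
  | zero => exact loopInvariant_start n J θ ω
  | succ m ih => exact loopInvariant_succ J θ ω hm (ih (by omega))

theorem output_eq_estimator {d n : ℕ} (hn : 2 ≤ n) (J : (Fin d → Bool) → ℝ) {θ : Fin d → ℝ}
    (hθ : ∀ i, θ i ∈ Set.Ioo (0 : ℝ) 1) {p : Fin d → ℝ × (Fin (n - 1) → ℝ)} {a : View d}
    (h : LoopInvariant n J θ p n a) (i : Fin d) :
    outCoord a.2 (a.1 i) .g = estimator J θ (fun j => copula (iterDir (n := n) (p j))) i := by
  -- For `n ≥ 2` the clamp is inactive, and the accumulators carry exactly the factor `1 / (n - 1)`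
  -- of `loorf_eq`.
  have hmax : max ((n : ℝ) - 1) 1 = n - 1 := by
    refine max_eq_left ?_
    have : (2 : ℝ) ≤ n := by exact_mod_cast hn
    linarith
  rw [estimator, loorf_eq hn, outCoord, Function.update_self, h.rho_eq, h.accJS_eq, h.accS_eq,
    h.mean_eq, hmax, rhoReal_eq_armsRho n (by omega)]
  simp only [Finset.sum_range, score_eq_scoreReal hθ]
  rfl

theorem iterARMSLaw_eq {d n : ℕ} (hn : 2 ≤ n) (J : (Fin d → Bool) → ℝ) {θ : Fin d → ℝ}
    (hθ : ∀ i, θ i ∈ Set.Ioo (0 : ℝ) 1) : iterARMSLaw d n J θ = origARMSLaw d n J θ := by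
  have hsim := simulates_iterARMS (d := d) n J
  have hout : Measurable fun (a : View d) i => a.1 i .g := by fun_prop
  have hest := measurable_estimator (n := n) J θ
  have hcopI : Measurable fun q : ℝ × (Fin (n - 1) → ℝ) => copula (iterDir (n := n) q) :=
    measurable_copula.comp measurable_iterDir
  have hcopO : Measurable fun u : Fin n → ℝ => copula (origDir u) :=
    measurable_copula.comp measurable_origDir
  have hsort : Measurable (sortSource (d := d) (n := n)) := by
    unfold sortSource; fun_prop
  have hpiI : Measurable fun (q : Fin d → ℝ × (Fin (n - 1) → ℝ)) i =>
      copula (iterDir (n := n) (q i)) :=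
    measurable_pi_iff.2 fun i => hcopI.comp (measurable_pi_apply i)
  have hpiO : Measurable fun (u : Fin d → Fin n → ℝ) i => copula (origDir (u i)) :=
    measurable_pi_iff.2 fun i => hcopO.comp (measurable_pi_apply i)
  have hlaw := congrArg (Measure.map fun (a : View d) i => a.1 i .g)
    (hsim.map_view (initState n θ) rfl)
  rw [Measure.map_map hout measurable_view, Measure.map_map hout (hsim.measurable_apply _)] at hlaw
  have hI := Measure.pi_map_pi (ι := Fin d) (μ := fun _ => iterSource n)
    (f := fun _ q => copula (iterDir (n := n) q))
    -- Sigma-finiteness of the iterative copula law is read off from its equality with the original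
    -- one.
    (hμ := fun _ => by rw [map_copula_iterDir n (by omega)]; infer_instance)
    fun _ => hcopI.aemeasurable
  have hO := Measure.pi_map_pi (ι := Fin d) (μ := fun _ => iidUnif n)
    (f := fun _ u => copula (origDir u)) fun _ => hcopO.aemeasurable
  rw [map_copula_iterDir n (by omega), ← hO, ← map_sortSource d n (by omega),
    Measure.map_map hpiI hsort] at hI
  have hfin := congrArg (Measure.map (estimator J θ)) hI
  rw [Measure.map_map hest (hpiI.comp hsort), Measure.map_map hest hpiO] at hfin
  refine Eq.trans hlaw (Eq.trans ?_ hfin)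
  congr 1
  funext ω i
  exact output_eq_estimator hn J hθ (loopInvariant_loopView J θ ω n le_rfl) i

/-! ### Memory. -/

theorem scratch_block_le {ι : Type} {d K : ℕ} {l : List (Cmd ι d)} (h : ∀ c ∈ l, c.scratch ≤ K) :
    (Cmd.block l).scratch ≤ K := by
  induction l with
  | nil => exact Nat.zero_le _
  | cons c l ih =>
    exact max_le (h c List.mem_cons_self) (ih fun c' hc => h c' (List.mem_cons_of_mem _ hc))

theorem scratch_forDim_le {ι : Type} {d K : ℕ} {f : Fin d → Cmd ι d} (h : ∀ i, (f i).scratch ≤ K) :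
    (Cmd.forDim f).scratch ≤ K := by
  refine scratch_block_le fun c hc => ?_
  obtain ⟨i, _, rfl⟩ := List.mem_map.1 hc
  exact h i

/-- Scratch space is reused between consecutive commands, and only the query buffer grows with `d`.
The total is at most `(8d + 8) + (d + 52)`, which is below `100 d` because `d ≥ 1`. -/
theorem memory_iterARMS_le {d : ℕ} (hd : 1 ≤ d) : (iterARMS d).memory ≤ 100 * d := by
  have hcard : Fintype.card (Reg d) = 8 * d + 8 := by
    rw [Fintype.card_sum, Fintype.card_prod, Fintype.card_fin]
    rfl
  have hround : (roundCmd d).scratch ≤ d + 50 := by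
    refine scratch_block_le fun c hc => ?_
    simp only [List.mem_cons, List.not_mem_nil, or_false] at hc
    rcases hc with rfl | rfl | rfl | rfl
    · refine scratch_forDim_le fun i => ?_
      simp [sampleCmd, Cmd.block, Cmd.scratch, Expr.size]
    · simp [Cmd.scratch]
    · simp [Cmd.scratch, Expr.size]
    · refine scratch_forDim_le fun i => ?_
      simp [Cmd.scratch, Expr.size, accExpr, scoreExpr]
  have hall : (iterARMS d).scratch ≤ d + 52 := by
    refine scratch_block_le fun c hc => ?_
    simp only [List.mem_cons, List.not_mem_nil, or_false] at hc
    rcases hc with rfl | rfl | rfl | rfl | rfl | rfl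
    · simp [Cmd.scratch, Expr.size]
    · exact scratch_forDim_le fun i => by simp [Cmd.scratch, Expr.size]
    · exact scratch_forDim_le fun i => by simp [Cmd.scratch, Expr.size]
    · exact scratch_forDim_le fun i => by simp [rhoCmd, rhoExpr, Cmd.scratch, Expr.size]
    · exact Nat.add_le_add_right hround 2
    · exact scratch_forDim_le fun i => by simp [Cmd.scratch, Expr.size]
  rw [Cmd.memory, hcard]
  omega

theorem map_sum_univ_origE (n : ℕ) (hn : 1 ≤ n) :
    (iidUnif n).map (fun u => ∑ s, origE u s) = gammaMeasure n 1 := by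
  obtain ⟨m, rfl⟩ : ∃ m, n = m + 1 := ⟨n - 1, by omega⟩
  exact (map_sum_origE m Finset.univ (by simp)).1

end ARMS

theorem mainTheorem6 :
    (∀ n : ℕ, 1 ≤ n →
      (ARMS.iidUnif n).map (fun u => ∑ s, ARMS.origE u s) = gammaMeasure n 1 ∧
      (∀ s : Fin n, (s : ℕ) + 1 < n →
        condDistrib (fun u => ARMS.origE u s) (fun u => ∑ t ∈ Finset.Ici s, ARMS.origE u t)
            (ARMS.iidUnif n)
          =ᵐ[(ARMS.iidUnif n).map fun u => ∑ t ∈ Finset.Ici s, ARMS.origE u t]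
            fun r => ARMS.unif.map (ARMS.invDraw n ((s : ℕ) + 1) r)) ∧
      (∀ p : ℝ × (Fin (n - 1) → ℝ), ∑ s, ARMS.iterE (n := n) p s = p.1) ∧
      (ARMS.iterSource n).map (ARMS.iterE (n := n)) =
        (ARMS.iidUnif n).map ARMS.origE ∧
      (ARMS.iterSource n).map (ARMS.iterDir (n := n)) =
        (ARMS.iidUnif n).map ARMS.origDir ∧
      (ARMS.iterSource n).map (fun p => ARMS.copula (ARMS.iterDir (n := n) p)) =
        (ARMS.iidUnif n).map (fun u => ARMS.copula (ARMS.origDir u))) ∧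
    (∃ C : ℕ, ∀ d : ℕ, 1 ≤ d →
      (ARMS.iterARMS d).memory ≤ C * d ∧
      ∀ n : ℕ, 2 ≤ n → ∀ (J : (Fin d → Bool) → ℝ) (θ : Fin d → ℝ),
        (∀ i, θ i ∈ Set.Ioo (0 : ℝ) 1) →
          ARMS.iterARMSLaw d n J θ = ARMS.origARMSLaw d n J θ) :=
  ⟨fun n hn => ⟨ARMS.map_sum_univ_origE n hn, ARMS.condDistrib_origE,
    ARMS.sum_iterE_eq_total n hn, ARMS.map_iterE n hn, ARMS.map_iterDir n hn,
    ARMS.map_copula_iterDir n hn⟩,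
    100, fun _ hd => ⟨ARMS.memory_iterARMS_le hd, fun _ hn J _ hθ =>
      ARMS.iterARMSLaw_eq hn J hθ⟩⟩
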